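/- Logarithms are natural. For a real polynomial $q$ in $x_1,\dots,x_n$ and $A$ uniform on $\{-1,1\}^n$, let $\mathrm{Inf}_i(q)=\mathbb E_A[\mathrm{Var}_{A_i}(q(A))]$ be the $i$-th influence of $q$ (the expectation, over the other coordinates, of the variance over the $i$-th coordinate). Call $q$ *$\tau$-regular* if $\mathrm{Inf}_i(q)\le\tau\,\mathrm{Var}(q(A))$ for all $i$, and say that $q$ *has constant sign with probability at least $1-\epsilon$* if $\Pr[\mathrm{sgn}(q(A))=s]\ge 1-\epsilon$ for some $s\in\{-1,1\}$, where $\mathrm{sgn}(0)=0$. For a partial assignment $\rho$ of values $\pm1$ to the variables, $q_\rho$ is the polynomial obtained from $q$ by substituting these values. There is an absolute constant $K$ such that the following two statements hold for all $n,d\ge 0$ and every real polynomial $p$ of degree at most $d$ in $n$ variables (with the convention $0^0=1$ when $d=0$). 1. (Decision tree.) For all $0<\tau,\epsilon,\delta<1/4$ there is a decision tree of depth at most $$\tau^{-1}\bigl(d\log(\tau^{-1})\log(\epsilon^{-1})\bigr)^{Kd}\log(\delta^{-1})$$ with variables at the internal nodes, no variable being queried twice on a path, such that each leaf, identified with the partial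 assignment $\rho$ made on the path to it, carries the restriction $p_\rho$, which has degree at most $d$, and the degree-$d$ polynomial threshold function $\mathrm{sgn}(p_\rho)$. The tree computes $p$ and $\mathrm{sgn}(p)$: for each $x\in\{-1,1\}^n$, if $\rho$ is the leaf reached by $x$, then $p_\rho(x)=p(x)$ and $\mathrm{sgn}(p_\rho(x))=\mathrm{sgn}(p(x))$. Moreover, if $\rho$ is the leaf at the end of a random path from the root (each branch taken with probability $1/2$), then with probability at least $1-\delta$ the polynomial $p_\rho$ is $\tau$-regular or has constant sign with probability at least $1-\epsilon$. 2. (One step.) For all $0<\tau,\epsilon<1/4$ there is a set $S$ of coordinates with $$|S|\le\tau^{-1}\bigl(d\log(\tau^{-1})\log(\epsilon^{-1})\bigr)^{Kd}$$ such that, if $\rho$ assigns independent uniform values in $\{-1,1\}$ to the coordinates in $S$, then with probability at least $2^{-Kd}$ the polynomial $p_\rho$ is $\tau$-regular or has constant sign with probability at least $1-\epsilon$. -/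

import Mathlib

namespace PTF

/-- The hypercube `{-1,1}^n`; the two elements of `ℤˣ` are `1` and `-1`. -/
abbrev Cube (n : ℕ) : Type := Fin n → ℤˣ

/-- Expectation of `f` at a uniformly random point of a finite type. -/
noncomputable def unifE {Ω : Type} [Fintype Ω] (f : Ω → ℝ) : ℝ :=
  (∑ ω, f ω) / (Fintype.card Ω : ℝ)

/-- Variance of `f` at a uniformly random point of a finite type. -/
noncomputable def unifVar {Ω : Type} [Fintype Ω] (f : Ω → ℝ) : ℝ :=
  unifE (fun ω => (f ω - unifE f) ^ 2)

open Classical in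
/-- Probability of the event `P` at a uniformly random point of a finite type. -/
noncomputable def unifPr {Ω : Type} [Fintype Ω] (P : Ω → Prop) : ℝ :=
  unifE (fun ω => if P ω then (1 : ℝ) else 0)

/-- The function on the hypercube given by a polynomial. -/
noncomputable def onCube {n : ℕ} (p : MvPolynomial (Fin n) ℝ) (x : Cube n) : ℝ :=
  MvPolynomial.eval (fun i => ((x i : ℤ) : ℝ)) p

/-- The polynomial threshold function `sgn(p(x))` on the hypercube. -/
noncomputable def threshold {n : ℕ} (p : MvPolynomial (Fin n) ℝ) (x : Cube n) : SignType :=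
  SignType.sign (onCube p x)

/-- The `i`-th influence `E_A[Var_{A_i}(f(A))]`: the average over the hypercube of the variance
of `f` when only the `i`-th coordinate is rerandomized. -/
noncomputable def influence {n : ℕ} (i : Fin n) (f : Cube n → ℝ) : ℝ :=
  unifE (fun x : Cube n => unifVar (fun s : ℤˣ => f (Function.update x i s)))

/-- `p` is `τ`-regular: every influence is at most `τ` times the variance. -/
def IsRegular {n : ℕ} (τ : ℝ) (p : MvPolynomial (Fin n) ℝ) : Prop :=
  ∀ i : Fin n, influence i (onCube p) ≤ τ * unifVar (onCube p)

/-- `p` has constant sign (`+1` or `-1`) with probability at least `1 - ε`. -/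
def HasConstantSign {n : ℕ} (ε : ℝ) (p : MvPolynomial (Fin n) ℝ) : Prop :=
  ∃ s : SignType, s ≠ 0 ∧ 1 - ε ≤ unifPr (fun x : Cube n => threshold p x = s)

/-- A partial assignment: `some s` fixes the coordinate to `s`, `none` leaves it free. -/
abbrev PartialAssignment (n : ℕ) : Type := Fin n → Option ℤˣ

/-- The restriction `p_ρ`, obtained by substituting into `p` the values that `ρ` fixes. -/
noncomputable def restrict {n : ℕ} (p : MvPolynomial (Fin n) ℝ) (ρ : PartialAssignment n) :
    MvPolynomial (Fin n) ℝ :=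
  MvPolynomial.bind₁
    (fun i => match ρ i with
      | none => MvPolynomial.X i
      | some s => MvPolynomial.C ((s : ℤ) : ℝ)) p

/-- The partial assignment that gives the coordinates in `S` their values in `x`. -/
def assignOn {n : ℕ} (S : Finset (Fin n)) (x : Cube n) : PartialAssignment n :=
  fun i => if i ∈ S then some (x i) else none

/-- Decision trees with variables at the internal nodes and labels in `α` at the leaves.
At `node i neg pos` one continues to `neg` if `x i = -1` and to `pos` if `x i = 1`. -/
inductive DecisionTree (n : ℕ) (α : Type) : Type
  | leaf (a : α) : DecisionTree n α
  | node (i : Fin n) (neg pos : DecisionTree n α) : DecisionTree n α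

namespace DecisionTree

/-- The number of internal nodes on a longest path from the root to a leaf. -/
def depth {n : ℕ} {α : Type} : DecisionTree n α → ℕ
  | leaf _ => 0
  | node _ neg pos => max neg.depth pos.depth + 1

/-- The label of the leaf reached by the input `x`. -/
def leafAt {n : ℕ} {α : Type} : DecisionTree n α → Cube n → α
  | leaf a, _ => a
  | node i neg pos, x => if x i = 1 then pos.leafAt x else neg.leafAt x

open Classical in
/-- The probability that a random path from the root (each branch taken with probability `1/2`)
ends in a leaf whose label satisfies `P`. -/
noncomputable def leafPr {n : ℕ} {α : Type} (P : α → Prop) : DecisionTree n α → ℝ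
  | leaf a => if P a then 1 else 0
  | node _ neg pos => (neg.leafPr P + pos.leafPr P) / 2

/-- `T.IsTreeOf p ρ`: below the partial assignment `ρ`, the tree `T` queries only coordinates
that are still free, never the same one twice on a path, and each leaf carries the restriction of
`p` to the assignment made by `ρ` and the path leading to that leaf. -/
def IsTreeOf {n : ℕ} (p : MvPolynomial (Fin n) ℝ) :
    DecisionTree n (MvPolynomial (Fin n) ℝ) → PartialAssignment n → Prop
  | leaf q, ρ => q = restrict p ρ
  | node i neg pos, ρ =>
      ρ i = none ∧ neg.IsTreeOf p (Function.update ρ i (some (-1))) ∧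
        pos.IsTreeOf p (Function.update ρ i (some 1))

/-- Every leaf label satisfies `P`. -/
def AllLeaves {n : ℕ} {α : Type} (P : α → Prop) : DecisionTree n α → Prop
  | leaf a => P a
  | node _ neg pos => neg.AllLeaves P ∧ pos.AllLeaves P

end DecisionTree

end PTF

/-!
Write a function on the hypercube as `∑_T c_T χ_T`. The variance is `∑_{T ≠ ∅} c_T²`, the `i`-th
influence is `∑_{T ∋ i} c_T²`, and when the coordinates in `S` are set to a random `x`, the square
of the coefficient at `U` of the restriction is the square at `x` of the function
`∑_{T \ S = U} c_T χ_T` (`slice`). So the variance and the influences of a random restriction are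
sums of squares of functions of degree at most `d`, whose moments hypercontractivity bounds
(`unifE_sum_sq_pow_le`). Hypercontractivity is proved one coordinate at a time: a two-point
inequality (`two_point_inequality`) replaces `(g + x_a h)^{2k}` by `(g² + C h²)^k`, and Minkowski's
inequality separates the two squares.

The set `S` is chosen greedily (`exists_greedy_finset`): as long as some coordinate outside `S`
carries more than a fraction `θ` of the influence remaining outside `S`, it is added, with `θ` equal
to `τ` up to a factor `(d log τ⁻¹)^{O(d)}`.

* If this stops, all influences outside `S` are small (`unifPr_isRegular_restrict`). By the
  Paley–Zygmund inequality the variance of the restriction is at least half its mean with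
  probability `2^{-O(d)}`, and the moments of order about `log τ⁻¹` of the influences, summed over
  all coordinates, show that these are all small except with a smaller probability.
* If it goes on for about `θ⁻¹ (log ε⁻¹ + O(d))` steps, the influence left outside `S` is
  negligible (`unifPr_hasConstantSign_restrict`). By Paley–Zygmund the mean of the restriction is of
  the order of the standard deviation of `p` with probability `2^{-O(d)}`, by Markov's inequality
  the variance of the restriction is much smaller, and Chebyshev's inequality fixes the sign.

The decision tree repeats such a restriction at every leaf that is not yet good
(`DecisionTree.exists_tree_of_rounds`); `2^{O(d)} log δ⁻¹` rounds leave a bad leaf with probability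
at most `δ`.
-/

namespace PTF

/-! ### Averages over a finite type -/

section Averages

variable {Ω : Type} [Fintype Ω]

theorem unifE_add (f g : Ω → ℝ) : unifE (fun ω => f ω + g ω) = unifE f + unifE g := by
  simp only [unifE, Finset.sum_add_distrib, add_div]

theorem unifE_const_mul (a : ℝ) (f : Ω → ℝ) : unifE (fun ω => a * f ω) = a * unifE f := by
  simp only [unifE, ← Finset.mul_sum, mul_div_assoc]

theorem unifE_sum {ι : Type*} (s : Finset ι) (f : ι → Ω → ℝ) :
    unifE (fun ω => ∑ j ∈ s, f j ω) = ∑ j ∈ s, unifE (f j) := by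
  simp only [unifE]
  rw [Finset.sum_comm, Finset.sum_div]

theorem unifE_const [Nonempty Ω] (a : ℝ) : unifE (fun _ : Ω => a) = a := by
  simp [unifE]

theorem unifE_mono {f g : Ω → ℝ} (h : ∀ ω, f ω ≤ g ω) : unifE f ≤ unifE g := by
  unfold unifE
  gcongr with ω
  exact h ω

theorem unifE_nonneg {f : Ω → ℝ} (h : ∀ ω, 0 ≤ f ω) : 0 ≤ unifE f :=
  div_nonneg (Finset.sum_nonneg fun ω _ => h ω) (Nat.cast_nonneg _)

theorem eq_zero_of_unifE_nonpos {f : Ω → ℝ} (h : ∀ ω, 0 ≤ f ω) (h0 : unifE f ≤ 0) (ω : Ω) :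
    f ω = 0 := by
  have hc : (0 : ℝ) < Fintype.card Ω := by
    have : Nonempty Ω := ⟨ω⟩
    exact_mod_cast Fintype.card_pos
  have hs : ∑ ω, f ω ≤ 0 := by
    unfold unifE at h0
    by_contra hlt
    exact absurd h0 (not_le.2 (div_pos (not_le.1 hlt) hc))
  have hs' : ∑ ω, f ω = 0 := le_antisymm hs (Finset.sum_nonneg fun ω _ => h ω)
  exact (Finset.sum_eq_zero_iff_of_nonneg fun ω _ => h ω).1 hs' ω (Finset.mem_univ _)

theorem unifE_comp_equiv (e : Ω ≃ Ω) (f : Ω → ℝ) : unifE (fun ω => f (e ω)) = unifE f := by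
  unfold unifE
  rw [Equiv.sum_comp e f]

theorem unifPr_mono {P Q : Ω → Prop} (h : ∀ ω, P ω → Q ω) : unifPr P ≤ unifPr Q := by
  classical
  refine unifE_mono fun ω => ?_
  by_cases hP : P ω
  · simp [hP, h ω hP]
  · by_cases hQ : Q ω <;> simp [hP, hQ]

theorem unifPr_eq_one [Nonempty Ω] {P : Ω → Prop} (h : ∀ ω, P ω) : unifPr P = 1 := by
  simp only [unifPr, h, if_true]
  exact unifE_const 1

theorem unifPr_le_add_of_imp {P Q R : Ω → Prop} (h : ∀ ω, P ω → Q ω ∨ R ω) :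
    unifPr P ≤ unifPr Q + unifPr R := by
  classical
  unfold unifPr
  rw [← unifE_add]
  refine unifE_mono fun ω => ?_
  have := h ω
  by_cases hP : P ω <;> by_cases hQ : Q ω <;> by_cases hR : R ω <;> simp_all

/-- Markov's inequality. -/
theorem unifPr_le_unifE_div {f : Ω → ℝ} {P : Ω → Prop} {t : ℝ} (ht : 0 < t)
    (hf : ∀ ω, 0 ≤ f ω) (hP : ∀ ω, P ω → t ≤ f ω) : unifPr P ≤ unifE f / t := by
  classical
  rw [div_eq_inv_mul, ← unifE_const_mul]
  refine unifE_mono fun ω => ?_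
  by_cases h : P ω
  · simp only [h, if_true]
    rw [← div_eq_inv_mul]
    exact (one_le_div ht).2 (hP ω h)
  · simp only [h, if_false]
    exact mul_nonneg (inv_nonneg.2 ht.le) (hf ω)

/-- The Paley–Zygmund inequality at half the mean. -/
theorem paley_zygmund_half [Nonempty Ω] {f : Ω → ℝ} {B : ℝ} (hf : ∀ ω, 0 ≤ f ω) (hB : 1 ≤ B)
    (h2 : unifE (fun ω => f ω ^ 2) ≤ B * unifE f ^ 2) :
    1 / (4 * B) ≤ unifPr (fun ω => unifE f / 2 ≤ f ω) := by
  classical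
  obtain ⟨m, hm⟩ : ∃ m, m = unifE f := ⟨_, rfl⟩
  rw [← hm] at h2 ⊢
  have hm0 : 0 ≤ m := hm ▸ unifE_nonneg hf
  have hB0 : 0 < B := by linarith
  rcases hm0.eq_or_lt with h0 | hpos
  · rw [unifPr_eq_one]
    · rw [div_le_one (by positivity)]
      linarith
    · intro ω
      rw [← h0]
      simpa using hf ω
  · -- Bounding `f` by AM-GM on the event, with weight `(4 B m)⁻¹` on `f ^ 2`, avoids
    -- square roots.
    have key : m ≤ m / 2 + ((4 * B * m)⁻¹ * unifE (fun ω => f ω ^ 2) +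
        B * m * unifPr (fun ω => m / 2 ≤ f ω)) := by
      unfold unifPr
      rw [← unifE_const_mul, ← unifE_const_mul, ← unifE_add]
      conv_rhs => lhs; rw [← unifE_const (Ω := Ω) (m / 2)]
      rw [← unifE_add]
      conv_lhs => rw [hm]
      refine unifE_mono fun ω => ?_
      have hq : 0 < 4 * B * m := by positivity
      by_cases h : m / 2 ≤ f ω
      · simp only [h, if_true]
        have : f ω ≤ (4 * B * m)⁻¹ * f ω ^ 2 + B * m := by
          rw [← sub_nonneg]
          have e : (4 * B * m)⁻¹ * f ω ^ 2 + B * m - f ω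
              = (4 * B * m)⁻¹ * (f ω - 2 * B * m) ^ 2 := by
            field_simp
            ring
          rw [e]
          positivity
        linarith
      · simp only [h, if_false]
        have : 0 ≤ (4 * B * m)⁻¹ * f ω ^ 2 := by positivity
        linarith
    have h3 : (4 * B * m)⁻¹ * unifE (fun ω => f ω ^ 2) ≤ m / 4 := by
      calc _ ≤ (4 * B * m)⁻¹ * (B * m ^ 2) := by gcongr
        _ = m / 4 := by field_simp
    have h4 : m * (1 / 4) ≤ m * (B * unifPr (fun ω => m / 2 ≤ f ω)) := by
      linarith
    have h5 := le_of_mul_le_mul_left h4 hpos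
    rw [div_le_iff₀ (by positivity)]
    linarith

theorem minkowski_add_pow [Nonempty Ω] {k : ℕ} (hk : k ≠ 0) {f g : Ω → ℝ} {a b : ℝ}
    (hf : ∀ ω, 0 ≤ f ω) (hg : ∀ ω, 0 ≤ g ω) (ha : 0 ≤ a) (hb : 0 ≤ b)
    (hfa : unifE (fun ω => f ω ^ k) ≤ a ^ k) (hgb : unifE (fun ω => g ω ^ k) ≤ b ^ k) :
    unifE (fun ω => (f ω + g ω) ^ k) ≤ (a + b) ^ k := by
  rcases ha.eq_or_lt with rfl | ha
  · rw [zero_pow hk] at hfa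
    have : ∀ ω, f ω = 0 := fun ω =>
      pow_eq_zero_iff hk |>.1 (eq_zero_of_unifE_nonpos (fun ω => pow_nonneg (hf ω) k) hfa ω)
    simpa [this] using hgb
  rcases hb.eq_or_lt with rfl | hb
  · rw [zero_pow hk] at hgb
    have : ∀ ω, g ω = 0 := fun ω =>
      pow_eq_zero_iff hk |>.1 (eq_zero_of_unifE_nonpos (fun ω => pow_nonneg (hg ω) k) hgb ω)
    simpa [this] using hfa
  -- Convexity of `t ↦ t ^ k` at `f / a` and `g / b`, with weights `a / (a + b)`, `b / (a + b)`.
  have hab : 0 < a + b := by linarith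
  have pt : ∀ ω, (f ω + g ω) ^ k ≤
      (a + b) ^ k * (a / (a + b) * (a ^ k)⁻¹) * f ω ^ k +
        (a + b) ^ k * (b / (a + b) * (b ^ k)⁻¹) * g ω ^ k := by
    intro ω
    have hc := (convexOn_pow k).2 (Set.mem_Ici.2 (div_nonneg (hf ω) ha.le))
      (Set.mem_Ici.2 (div_nonneg (hg ω) hb.le)) (div_nonneg ha.le hab.le)
      (div_nonneg hb.le hab.le) (by field_simp)
    simp only [smul_eq_mul] at hc
    have e : a / (a + b) * (f ω / a) + b / (a + b) * (g ω / b) = (f ω + g ω) / (a + b) := by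
      field_simp
    rw [e, div_pow, div_pow, div_pow, div_le_iff₀ (by positivity)] at hc
    refine hc.trans_eq ?_
    rw [div_eq_mul_inv (f ω ^ k), div_eq_mul_inv (g ω ^ k)]
    ring
  calc _ ≤ _ := unifE_mono pt
    _ = (a + b) ^ k * (a / (a + b) * (a ^ k)⁻¹) * unifE (fun ω => f ω ^ k) +
        (a + b) ^ k * (b / (a + b) * (b ^ k)⁻¹) * unifE (fun ω => g ω ^ k) := by
      rw [unifE_add, unifE_const_mul, unifE_const_mul]
    _ ≤ (a + b) ^ k * (a / (a + b) * (a ^ k)⁻¹) * a ^ k +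
        (a + b) ^ k * (b / (a + b) * (b ^ k)⁻¹) * b ^ k := by gcongr
    _ = (a + b) ^ k := by
      have h1 : a ^ k ≠ 0 := by positivity
      have h2 : b ^ k ≠ 0 := by positivity
      field_simp

theorem minkowski_sum_pow [Nonempty Ω] {ι : Type*} (s : Finset ι) {k : ℕ} (hk : k ≠ 0)
    {f : ι → Ω → ℝ} {a : ι → ℝ} (hf : ∀ j ω, 0 ≤ f j ω) (ha : ∀ j, 0 ≤ a j)
    (h : ∀ j, unifE (fun ω => f j ω ^ k) ≤ a j ^ k) :
    unifE (fun ω => (∑ j ∈ s, f j ω) ^ k) ≤ (∑ j ∈ s, a j) ^ k := by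
  classical
  induction s using Finset.induction_on with
  | empty => simp [zero_pow hk, unifE_const]
  | insert j s hj ih =>
    simp only [Finset.sum_insert hj]
    exact minkowski_add_pow hk (hf j) (fun ω => Finset.sum_nonneg fun i _ => hf i ω) (ha j)
      (Finset.sum_nonneg fun i _ => ha i) (h j) ih

end Averages

/-! ### Fourier expansions on the hypercube -/

variable {n : ℕ}

/-- The character `χ_T(x) = ∏_{i ∈ T} x_i`. -/
noncomputable def chi (T : Finset (Fin n)) (x : Cube n) : ℝ :=
  ∏ i ∈ T, ((x i : ℤ) : ℝ)

/-- The function `∑_T c_T χ_T` on the hypercube with Fourier coefficients `c`. -/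
noncomputable def fourier (c : Finset (Fin n) → ℝ) (x : Cube n) : ℝ :=
  ∑ T, c T * chi T x

theorem unit_cast_sq (s : ℤˣ) : ((s : ℤ) : ℝ) ^ 2 = 1 := by
  rcases Int.units_eq_one_or s with rfl | rfl <;> simp

theorem chi_empty (x : Cube n) : chi ∅ x = 1 := by
  simp [chi]

theorem chi_sq (T : Finset (Fin n)) (x : Cube n) : chi T x ^ 2 = 1 := by
  simp [chi, ← Finset.prod_pow, unit_cast_sq]

/-- The involution of the hypercube that flips the coordinate `i`. -/
def flip (i : Fin n) : Cube n ≃ Cube n where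
  toFun x := Function.update x i (-x i)
  invFun x := Function.update x i (-x i)
  left_inv x := by simp
  right_inv x := by simp

theorem chi_update_of_notMem {T : Finset (Fin n)} {i : Fin n} (h : i ∉ T) (x : Cube n) (s : ℤˣ) :
    chi T (Function.update x i s) = chi T x := by
  refine Finset.prod_congr rfl fun j hj => ?_
  rw [Function.update_of_ne (ne_of_mem_of_not_mem hj h)]

theorem chi_update_of_mem {T : Finset (Fin n)} {i : Fin n} (h : i ∈ T) (x : Cube n) (s : ℤˣ) :
    chi T (Function.update x i s) = ((s : ℤ) : ℝ) * ((x i : ℤ) : ℝ) * chi T x := by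
  have e : ∀ y : Cube n, chi T y = ((y i : ℤ) : ℝ) * chi (T.erase i) y := fun y =>
    (Finset.mul_prod_erase T _ h).symm
  rw [e, e x, chi_update_of_notMem (Finset.notMem_erase i T), Function.update_self]
  linear_combination (-((s : ℤ) : ℝ) * chi (T.erase i) x) * unit_cast_sq (x i)

theorem chi_flip_of_notMem {T : Finset (Fin n)} {i : Fin n} (h : i ∉ T) (x : Cube n) :
    chi T (flip i x) = chi T x :=
  chi_update_of_notMem h x _

theorem chi_flip_of_mem {T : Finset (Fin n)} {i : Fin n} (h : i ∈ T) (x : Cube n) :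
    chi T (flip i x) = -chi T x := by
  refine (chi_update_of_mem h x _).trans ?_
  push_cast
  linear_combination -chi T x * unit_cast_sq (x i)

theorem unifE_chi_mul_chi (T U : Finset (Fin n)) :
    unifE (fun x => chi T x * chi U x) = if T = U then 1 else 0 := by
  split_ifs with h
  · subst h
    simp only [← pow_two, chi_sq]
    exact unifE_const 1
  · obtain ⟨i, hi⟩ : ∃ i, ¬ (i ∈ T ↔ i ∈ U) := by
      by_contra! hc
      exact h (Finset.ext hc)
    have e := unifE_comp_equiv (flip i) (fun x => chi T x * chi U x)
    have e' : ∀ x, chi T (flip i x) * chi U (flip i x) = (-1) * (chi T x * chi U x) := by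
      intro x
      by_cases hT : i ∈ T
      · rw [chi_flip_of_mem hT, chi_flip_of_notMem (by tauto)]
        ring
      · rw [chi_flip_of_notMem hT, chi_flip_of_mem (by tauto)]
        ring
    simp only [e', unifE_const_mul] at e
    linarith

/-- Parseval's identity. -/
theorem unifE_fourier_sq (c : Finset (Fin n) → ℝ) :
    unifE (fun x => fourier c x ^ 2) = ∑ T, c T ^ 2 := by
  have e : ∀ x, fourier c x ^ 2 = ∑ T, ∑ U, (c T * c U) * (chi T x * chi U x) := by
    intro x
    rw [fourier, pow_two, Finset.sum_mul_sum]
    refine Finset.sum_congr rfl fun T _ => Finset.sum_congr rfl fun U _ => ?_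
    ring
  simp only [e, unifE_sum, unifE_const_mul, unifE_chi_mul_chi]
  simp [pow_two]

theorem unifE_fourier (c : Finset (Fin n) → ℝ) : unifE (fourier c) = c ∅ := by
  have e : ∀ x, fourier c x = ∑ T, c T * (chi T x * chi ∅ x) := by
    intro x
    simp [fourier, chi_empty]
  rw [show fourier c = _ from funext e]
  simp only [unifE_sum, unifE_const_mul, unifE_chi_mul_chi]
  simp

/-- The Fourier coefficients `c`, set to zero outside the sets satisfying `P`. -/
noncomputable def filterCoeff (P : Finset (Fin n) → Prop) [DecidablePred P]
    (c : Finset (Fin n) → ℝ) (T : Finset (Fin n)) : ℝ :=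
  if P T then c T else 0

theorem sum_filterCoeff_sq (P : Finset (Fin n) → Prop) [DecidablePred P]
    (c : Finset (Fin n) → ℝ) :
    ∑ T, filterCoeff P c T ^ 2 = ∑ T with P T, c T ^ 2 := by
  rw [Finset.sum_filter]
  refine Finset.sum_congr rfl fun T _ => ?_
  unfold filterCoeff
  split_ifs <;> simp

theorem fourier_eq_add_filterCoeff (P : Finset (Fin n) → Prop) [DecidablePred P]
    (c : Finset (Fin n) → ℝ) (x : Cube n) :
    fourier c x = fourier (filterCoeff (fun T => ¬ P T) c) x + fourier (filterCoeff P c) x := by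
  unfold fourier
  rw [← Finset.sum_add_distrib]
  refine Finset.sum_congr rfl fun T _ => ?_
  unfold filterCoeff
  split_ifs <;> simp_all

theorem unifVar_fourier (c : Finset (Fin n) → ℝ) :
    unifVar (fourier c) = ∑ T with T ≠ ∅, c T ^ 2 := by
  have e : ∀ x, fourier c x - unifE (fourier c) = fourier (filterCoeff (fun T => T ≠ ∅) c) x := by
    intro x
    rw [fourier_eq_add_filterCoeff (fun T => T ≠ ∅) c x, unifE_fourier, add_sub_right_comm]
    simp [fourier, filterCoeff, chi_empty]
  simp only [unifVar, e, unifE_fourier_sq, sum_filterCoeff_sq]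

theorem fourier_update (c : Finset (Fin n) → ℝ) (i : Fin n) (x : Cube n) (s : ℤˣ) :
    fourier c (Function.update x i s) =
      fourier (filterCoeff (fun T => i ∉ T) c) x +
        ((s : ℤ) : ℝ) * (((x i : ℤ) : ℝ) * fourier (filterCoeff (fun T => i ∈ T) c) x) := by
  unfold fourier
  rw [Finset.mul_sum, Finset.mul_sum, ← Finset.sum_add_distrib]
  refine Finset.sum_congr rfl fun T _ => ?_
  unfold filterCoeff
  by_cases h : i ∈ T
  · simp only [h, chi_update_of_mem h, if_true, not_true_eq_false, if_false]
    ring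
  · simp [h, chi_update_of_notMem h]

theorem unifE_units (f : ℤˣ → ℝ) : unifE f = (f 1 + f (-1)) / 2 := by
  have h : (Finset.univ : Finset ℤˣ) = {1, -1} := by decide
  have hc : Fintype.card ℤˣ = 2 := by decide
  rw [unifE, h, Finset.sum_pair (by decide), hc]
  norm_num

theorem influence_fourier (i : Fin n) (c : Finset (Fin n) → ℝ) :
    influence i (fourier c) = ∑ T with i ∈ T, c T ^ 2 := by
  rw [← sum_filterCoeff_sq, ← unifE_fourier_sq]
  unfold influence
  congr 1
  ext x
  simp only [fourier_update, unifVar, unifE_units]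
  push_cast
  linear_combination (fourier (filterCoeff (fun T => i ∈ T) c) x) ^ 2 * unit_cast_sq (x i)

/-- Reducing the exponents modulo `2` writes a polynomial of degree at most `d` on the hypercube
as a Fourier expansion over sets of at most `d` coordinates. -/
theorem exists_onCube_eq_fourier {d : ℕ} (p : MvPolynomial (Fin n) ℝ) (hp : p.totalDegree ≤ d) :
    ∃ c : Finset (Fin n) → ℝ, (∀ T, c T ≠ 0 → T.card ≤ d) ∧ onCube p = fourier c := by
  classical
  have hmono : ∀ (m : Fin n →₀ ℕ) (x : Cube n),
      ∏ i, ((x i : ℤ) : ℝ) ^ m i = chi (Finset.univ.filter fun i => Odd (m i)) x := by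
    intro m x
    rw [chi, Finset.prod_filter]
    refine Finset.prod_congr rfl fun i _ => ?_
    split_ifs with h
    · obtain ⟨k, hk⟩ := h
      rw [hk, pow_succ, pow_mul, unit_cast_sq, one_pow, one_mul]
    · obtain ⟨k, hk⟩ := Nat.not_odd_iff_even.1 h
      rw [hk, ← two_mul, pow_mul, unit_cast_sq, one_pow]
  refine ⟨fun T => ∑ m ∈ p.support with (Finset.univ.filter fun i => Odd (m i)) = T,
    p.coeff m, ?_, ?_⟩
  · intro T hT
    obtain ⟨m, hm, -⟩ := Finset.exists_ne_zero_of_sum_ne_zero hT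
    obtain ⟨hms, rfl⟩ := Finset.mem_filter.1 hm
    calc _ = ∑ i with Odd (m i), 1 := by simp
      _ ≤ ∑ i with Odd (m i), m i :=
        Finset.sum_le_sum fun i hi => (Finset.mem_filter.1 hi).2.pos
      _ ≤ ∑ i, m i := Finset.sum_le_sum_of_subset (Finset.filter_subset _ _)
      _ = m.sum fun _ e => e := (Finsupp.sum_fintype m (fun _ e => e) fun _ => rfl).symm
      _ ≤ d := (MvPolynomial.le_totalDegree hms).trans hp
  · ext x
    rw [onCube, MvPolynomial.eval_eq', fourier]
    simp only [hmono, Finset.sum_filter, Finset.sum_mul]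
    rw [Finset.sum_comm]
    refine Finset.sum_congr rfl fun m _ => ?_
    simp

/-! ### Hypercontractivity -/

/-- The two-point inequality behind hypercontractivity. -/
theorem two_point_inequality {k : ℕ} {C : ℝ} (hC : 4 * k + 1 ≤ C) (g h : ℝ) :
    ((g + h) ^ (2 * k) + (g - h) ^ (2 * k)) / 2 ≤ (g ^ 2 + C * h ^ 2) ^ k := by
  -- With `A` and `B` the even and odd parts in `h`, multiplication by `(g + h) ^ 2` sends
  -- `(A, B)` to `(s A + t B, t A + s B)`, where `s = g ^ 2 + h ^ 2` and `t = 2 g h`.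
  obtain ⟨P, hP⟩ : ∃ P, P = g ^ 2 + C * h ^ 2 := ⟨_, rfl⟩
  rw [← hP]
  have hC1 : 1 ≤ C := le_trans (by linarith [(Nat.cast_nonneg k : (0 : ℝ) ≤ k)]) hC
  have hh : 0 ≤ h ^ 2 := sq_nonneg h
  have hP0 : 0 ≤ P := by rw [hP]; positivity
  have hsP : g ^ 2 + h ^ 2 ≤ P := by nlinarith
  have key : ∀ j ≤ k, ((g + h) ^ (2 * j) + (g - h) ^ (2 * j)) / 2 ≤ P ^ j ∧
      P * (2 * g * h * (((g + h) ^ (2 * j) - (g - h) ^ (2 * j)) / 2)) ≤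
        j * (2 * g * h) ^ 2 * P ^ j := by
    intro j
    induction j with
    | zero => intro _; simp
    | succ j ih =>
      intro hj
      obtain ⟨h1, h2⟩ := ih (by omega)
      obtain ⟨A, hA⟩ : ∃ A, A = ((g + h) ^ (2 * j) + (g - h) ^ (2 * j)) / 2 := ⟨_, rfl⟩
      obtain ⟨B, hB⟩ : ∃ B, B = ((g + h) ^ (2 * j) - (g - h) ^ (2 * j)) / 2 := ⟨_, rfl⟩
      have eA : ((g + h) ^ (2 * (j + 1)) + (g - h) ^ (2 * (j + 1))) / 2
          = (g ^ 2 + h ^ 2) * A + 2 * g * h * B := by rw [hA, hB]; ring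
      have eB : ((g + h) ^ (2 * (j + 1)) - (g - h) ^ (2 * (j + 1))) / 2
          = 2 * g * h * A + (g ^ 2 + h ^ 2) * B := by rw [hA, hB]; ring
      rw [eA, eB]
      rw [← hA] at h1
      rw [← hB] at h2
      have hj' : ((j : ℝ) + 1) ≤ k := by exact_mod_cast hj
      have hs0 : 0 ≤ g ^ 2 + h ^ 2 := by positivity
      have hPj : 0 ≤ P ^ j := pow_nonneg hP0 j
      have ht : 0 ≤ (2 * g * h) ^ 2 := sq_nonneg _
      refine ⟨?_, ?_⟩
      · rcases hP0.eq_or_lt with h0 | hpos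
        · have hg0 : g ^ 2 = 0 := by nlinarith [sq_nonneg g]
          have hh0 : h ^ 2 = 0 := by nlinarith [sq_nonneg g]
          rw [pow_eq_zero_iff two_ne_zero] at hg0 hh0
          rw [← h0, hg0, hh0]
          simp
        · refine le_of_mul_le_mul_left ?_ hpos
          have e1 : j * (2 * g * h) ^ 2 ≤ P * (P - (g ^ 2 + h ^ 2)) := by
            have : P - (g ^ 2 + h ^ 2) = (C - 1) * h ^ 2 := by rw [hP]; ring
            rw [this]
            have e2 : (4 * j : ℝ) ≤ C - 1 := by linarith
            have e3 : g ^ 2 ≤ P := by nlinarith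
            calc (j : ℝ) * (2 * g * h) ^ 2 = g ^ 2 * ((4 * j) * h ^ 2) := by ring
              _ ≤ P * ((C - 1) * h ^ 2) := by gcongr
          calc P * ((g ^ 2 + h ^ 2) * A + 2 * g * h * B)
              = P * (g ^ 2 + h ^ 2) * A + P * (2 * g * h * B) := by ring
            _ ≤ P * (g ^ 2 + h ^ 2) * P ^ j + j * (2 * g * h) ^ 2 * P ^ j := by gcongr
            _ ≤ P * (g ^ 2 + h ^ 2) * P ^ j + P * (P - (g ^ 2 + h ^ 2)) * P ^ j := by gcongr
            _ = P * P ^ (j + 1) := by ring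
      · calc P * (2 * g * h * (2 * g * h * A + (g ^ 2 + h ^ 2) * B))
            = P * (2 * g * h) ^ 2 * A + (g ^ 2 + h ^ 2) * (P * (2 * g * h * B)) := by ring
          _ ≤ P * (2 * g * h) ^ 2 * P ^ j + (g ^ 2 + h ^ 2) * (j * (2 * g * h) ^ 2 * P ^ j) := by
            gcongr
          _ ≤ P * (2 * g * h) ^ 2 * P ^ j + P * (j * (2 * g * h) ^ 2 * P ^ j) := by
            gcongr
          _ = _ := by push_cast; ring
  exact (key k le_rfl).1

/-- Hypercontractivity in the variables of `S`, for a function all of whose characters agree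
outside `S`. -/
theorem unifE_fourier_pow_le_of_sdiff {k : ℕ} (hk : k ≠ 0) {C : ℝ} (hC : 4 * k + 1 ≤ C)
    (S : Finset (Fin n)) :
    ∀ (U : Finset (Fin n)) (c : Finset (Fin n) → ℝ), (∀ T, c T ≠ 0 → T \ S = U) →
      unifE (fun x => fourier c x ^ (2 * k)) ≤ (∑ T, C ^ (T ∩ S).card * c T ^ 2) ^ k := by
  have hC0 : 0 ≤ C := le_trans (by positivity) hC
  induction S using Finset.induction_on with
  | empty =>
    intro U c hc
    have hz : ∀ T, T ≠ U → c T = 0 := by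
      intro T hT
      by_contra h
      exact hT (by simpa using hc T h)
    have e : ∀ x, fourier c x = c U * chi U x := fun x =>
      Finset.sum_eq_single U (fun T _ hT => by simp [hz T hT]) (by simp)
    have e' : ∑ T, C ^ (T ∩ ∅).card * c T ^ 2 = c U ^ 2 := by
      rw [Finset.sum_eq_single U (fun T _ hT => by simp [hz T hT]) (by simp)]
      simp
    simp only [e, e', pow_mul, mul_pow, chi_sq, mul_one]
    exact (unifE_const _).le
  | insert a S ha ih =>
    intro U c hc
    have hg := ih U (filterCoeff (fun T => a ∉ T) c) (by
      intro T hT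
      have h1 : a ∉ T := by
        by_contra h
        exact hT (by simp [filterCoeff, h])
      rw [← hc T (by simpa [filterCoeff, h1] using hT)]
      ext j
      simp only [Finset.mem_sdiff, Finset.mem_insert]
      refine ⟨fun ⟨h2, h3⟩ => ⟨h2, ?_⟩, fun ⟨h2, h3⟩ => ⟨h2, fun h4 => h3 (Or.inr h4)⟩⟩
      rintro (rfl | h4)
      exacts [h1 h2, h3 h4])
    have hh := ih (insert a U) (filterCoeff (fun T => a ∈ T) c) (by
      intro T hT
      have h1 : a ∈ T := by
        by_contra h
        exact hT (by simp [filterCoeff, h])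
      rw [← hc T (by simpa [filterCoeff, h1] using hT)]
      ext j
      simp only [Finset.mem_sdiff, Finset.mem_insert]
      by_cases hja : j = a
      · subst hja
        simp [h1, ha]
      · simp [hja])
    have hflip : ∀ x, fourier c (flip a x) = fourier (filterCoeff (fun T => a ∉ T) c) x -
        fourier (filterCoeff (fun T => a ∈ T) c) x := by
      intro x
      refine (fourier_update c a x _).trans ?_
      push_cast
      linear_combination (-fourier (filterCoeff (fun T => a ∈ T) c) x) * unit_cast_sq (x a)
    have hsplit := fourier_eq_add_filterCoeff (fun T => a ∈ T) c
    have e1 : unifE (fun x => fourier c x ^ (2 * k)) =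
        unifE (fun x => (fourier c x ^ (2 * k) + fourier c (flip a x) ^ (2 * k)) / 2) := by
      simp only [div_eq_inv_mul, unifE_const_mul, unifE_add]
      rw [unifE_comp_equiv (flip a) (fun x => fourier c x ^ (2 * k))]
      ring
    have e2 : ∀ b : Finset (Fin n) → ℝ, 0 ≤ ∑ T, C ^ (T ∩ S).card * b T ^ 2 := fun b =>
      Finset.sum_nonneg fun T _ => mul_nonneg (pow_nonneg hC0 _) (sq_nonneg _)
    rw [e1]
    calc _ ≤ unifE (fun x => (fourier (filterCoeff (fun T => a ∉ T) c) x ^ 2 +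
          C * fourier (filterCoeff (fun T => a ∈ T) c) x ^ 2) ^ k) := by
          refine unifE_mono fun x => ?_
          rw [hflip, hsplit]
          exact two_point_inequality hC _ _
      _ ≤ (∑ T, C ^ (T ∩ S).card * filterCoeff (fun T => a ∉ T) c T ^ 2 +
          C * ∑ T, C ^ (T ∩ S).card * filterCoeff (fun T => a ∈ T) c T ^ 2) ^ k := by
          refine minkowski_add_pow hk (fun x => sq_nonneg _)
            (fun x => mul_nonneg hC0 (sq_nonneg _)) (e2 _) (mul_nonneg hC0 (e2 _)) ?_ ?_
          · simpa only [← pow_mul] using hg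
          · simp only [mul_pow, unifE_const_mul, ← pow_mul]
            gcongr
      _ = _ := by
          congr 1
          rw [Finset.mul_sum, ← Finset.sum_add_distrib]
          refine Finset.sum_congr rfl fun T _ => ?_
          unfold filterCoeff
          by_cases h : a ∈ T
          · have : (T ∩ insert a S).card = (T ∩ S).card + 1 := by
              rw [Finset.inter_insert_of_mem h, Finset.card_insert_of_notMem (by simp [ha])]
            simp only [h, this, if_true, not_true_eq_false, if_false]
            ring
          · simp [h, Finset.inter_insert_of_notMem h]

/-- Hypercontractivity: a function of degree at most `d` has `2k`-norm at most
`(4k+1)^{d/2}` times its `2`-norm. -/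
theorem unifE_fourier_pow_le {k d : ℕ} (hk : k ≠ 0) {c : Finset (Fin n) → ℝ}
    (hc : ∀ T, c T ≠ 0 → T.card ≤ d) :
    unifE (fun x => fourier c x ^ (2 * k)) ≤
      ((4 * k + 1 : ℝ) ^ d * unifE (fun x => fourier c x ^ 2)) ^ k := by
  have h1 : (1 : ℝ) ≤ 4 * k + 1 := by linarith [(Nat.cast_nonneg k : (0 : ℝ) ≤ k)]
  refine (unifE_fourier_pow_le_of_sdiff hk le_rfl Finset.univ ∅ c (by simp)).trans ?_
  rw [unifE_fourier_sq, Finset.mul_sum]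
  refine pow_le_pow_left₀ (Finset.sum_nonneg fun T _ => by positivity) ?_ k
  refine Finset.sum_le_sum fun T _ => ?_
  by_cases h : c T = 0
  · simp [h]
  · gcongr
    exact (Finset.card_le_card Finset.inter_subset_left).trans (hc T h)

/-- Moments of a sum of squares of functions of degree at most `d`. -/
theorem unifE_sum_sq_pow_le {ι : Type*} (s : Finset ι) {k d : ℕ} (hk : k ≠ 0)
    {c : ι → Finset (Fin n) → ℝ} (hc : ∀ j T, c j T ≠ 0 → T.card ≤ d) :
    unifE (fun x => (∑ j ∈ s, fourier (c j) x ^ 2) ^ k) ≤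
      ((4 * k + 1 : ℝ) ^ d * unifE (fun x => ∑ j ∈ s, fourier (c j) x ^ 2)) ^ k := by
  rw [unifE_sum, Finset.mul_sum]
  refine minkowski_sum_pow s hk (fun j x => sq_nonneg _)
    (fun j => mul_nonneg (by positivity) (unifE_nonneg fun x => sq_nonneg _)) fun j => ?_
  simpa only [← pow_mul] using unifE_fourier_pow_le hk (hc j)

/-! ### Restrictions -/

theorem onCube_restrict (p : MvPolynomial (Fin n) ℝ) (ρ : PartialAssignment n) (y : Cube n) :
    onCube (restrict p ρ) y = onCube p (fun i => (ρ i).getD (y i)) := by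
  unfold onCube restrict
  rw [← MvPolynomial.coe_aeval_eq_eval, ← MvPolynomial.coe_aeval_eq_eval]
  simp only [RingHom.coe_coe]
  rw [MvPolynomial.aeval_bind₁]
  congr 2
  ext i
  cases ρ i <;> simp

theorem totalDegree_restrict_le (p : MvPolynomial (Fin n) ℝ) (ρ : PartialAssignment n) :
    (restrict p ρ).totalDegree ≤ p.totalDegree := by
  have hi : ∀ i, (match ρ i with
      | none => MvPolynomial.X i
      | some s => MvPolynomial.C ((s : ℤ) : ℝ) : MvPolynomial (Fin n) ℝ).totalDegree ≤ 1 := by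
    intro i
    rcases ρ i with _ | s
    · exact (MvPolynomial.totalDegree_X i).le
    · exact (MvPolynomial.totalDegree_C _).le.trans zero_le_one
  unfold restrict
  conv_lhs => rw [p.as_sum, map_sum]
  refine MvPolynomial.totalDegree_finsetSum_le fun m hm => ?_
  rw [MvPolynomial.bind₁_monomial]
  refine (MvPolynomial.totalDegree_mul _ _).trans ?_
  rw [MvPolynomial.totalDegree_C, zero_add]
  refine ((MvPolynomial.totalDegree_finsetProd _ _).trans ?_).trans
    (MvPolynomial.le_totalDegree hm)
  refine Finset.sum_le_sum fun i _ => ?_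
  refine (MvPolynomial.totalDegree_pow _ _).trans ?_
  exact (Nat.mul_le_mul_left _ (hi i)).trans_eq (mul_one _)

theorem restrict_none (p : MvPolynomial (Fin n) ℝ) : restrict p (fun _ => none) = p :=
  MvPolynomial.aeval_X_left_apply p

theorem restrict_restrict (p : MvPolynomial (Fin n) ℝ) (ρ σ : PartialAssignment n) :
    restrict (restrict p ρ) σ = restrict p (fun i => (ρ i).orElse fun _ => σ i) := by
  unfold restrict
  rw [MvPolynomial.bind₁_bind₁]
  congr 2
  ext i : 1
  cases h : ρ i <;> simp [h]

/-- The part of a Fourier expansion carried by the sets `T` with `T \ S = U`. Up to a sign, its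
value at `x` is the coefficient at `U` of the restriction that gives `S` its values in `x`. -/
noncomputable def slice (S : Finset (Fin n)) (c : Finset (Fin n) → ℝ) (U : Finset (Fin n)) :
    Finset (Fin n) → ℝ :=
  filterCoeff (fun T => T \ S = U) c

theorem slice_ne_zero {S U T : Finset (Fin n)} {c : Finset (Fin n) → ℝ} (h : slice S c U T ≠ 0) :
    c T ≠ 0 := by
  intro h0
  exact h (by simp [slice, filterCoeff, h0])

theorem unifE_sum_slice_sq (S : Finset (Fin n)) (c : Finset (Fin n) → ℝ)
    (P : Finset (Fin n) → Prop) [DecidablePred P] :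
    unifE (fun x => ∑ U with P U, fourier (slice S c U) x ^ 2) = ∑ T with P (T \ S), c T ^ 2 := by
  simp only [unifE_sum, unifE_fourier_sq, slice, sum_filterCoeff_sq]
  simp only [Finset.sum_filter]
  simp only [← Finset.sum_filter (p := P)]
  rw [Finset.sum_comm]
  refine Finset.sum_congr rfl fun T _ => ?_
  rw [Finset.sum_ite_eq]
  simp

/-- The Fourier coefficients of the restriction that gives `S` its values in `x`. -/
noncomputable def restrictCoeff (S : Finset (Fin n)) (c : Finset (Fin n) → ℝ) (x : Cube n)
    (U : Finset (Fin n)) : ℝ :=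
  ∑ T with T \ S = U, c T * chi (T ∩ S) x

theorem restrictCoeff_mul_chi (S : Finset (Fin n)) (c : Finset (Fin n) → ℝ) (x : Cube n)
    (U : Finset (Fin n)) :
    restrictCoeff S c x U * chi U x = fourier (slice S c U) x := by
  unfold restrictCoeff fourier slice filterCoeff
  rw [Finset.sum_mul, Finset.sum_filter]
  refine Finset.sum_congr rfl fun T _ => ?_
  split_ifs with h
  · rw [← h, mul_assoc]
    congr 1
    exact Finset.prod_inter_mul_prod_sdiff T S _
  · simp

theorem restrictCoeff_sq (S : Finset (Fin n)) (c : Finset (Fin n) → ℝ) (x : Cube n)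
    (U : Finset (Fin n)) :
    restrictCoeff S c x U ^ 2 = fourier (slice S c U) x ^ 2 := by
  rw [← restrictCoeff_mul_chi, mul_pow, chi_sq, mul_one]

theorem onCube_restrict_assignOn {p : MvPolynomial (Fin n) ℝ} {c : Finset (Fin n) → ℝ}
    (hp : onCube p = fourier c) (S : Finset (Fin n)) (x : Cube n) :
    onCube (restrict p (assignOn S x)) = fourier (restrictCoeff S c x) := by
  ext y
  rw [onCube_restrict, hp]
  unfold fourier restrictCoeff
  simp only [Finset.sum_filter, Finset.sum_mul]
  rw [Finset.sum_comm]
  refine Finset.sum_congr rfl fun T _ => ?_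
  have h : chi T (fun i => (assignOn S x i).getD (y i)) = chi (T ∩ S) x * chi (T \ S) y := by
    unfold chi
    rw [← Finset.prod_inter_mul_prod_sdiff T S]
    congr 1
    · refine Finset.prod_congr rfl fun i hi => ?_
      simp [assignOn, (Finset.mem_inter.1 hi).2]
    · refine Finset.prod_congr rfl fun i hi => ?_
      simp [assignOn, (Finset.mem_sdiff.1 hi).2]
  rw [h, Finset.sum_eq_single (T \ S)]
  · simp [mul_assoc]
  · intro U _ hU
    simp [hU.symm]
  · simp

theorem unifVar_restrict {p : MvPolynomial (Fin n) ℝ} {c : Finset (Fin n) → ℝ}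
    (hp : onCube p = fourier c) (S : Finset (Fin n)) (x : Cube n) :
    unifVar (onCube (restrict p (assignOn S x))) =
      ∑ U with U ≠ ∅, fourier (slice S c U) x ^ 2 := by
  simp only [onCube_restrict_assignOn hp, unifVar_fourier, restrictCoeff_sq]

theorem influence_restrict {p : MvPolynomial (Fin n) ℝ} {c : Finset (Fin n) → ℝ}
    (hp : onCube p = fourier c) (S : Finset (Fin n)) (x : Cube n) (i : Fin n) :
    influence i (onCube (restrict p (assignOn S x))) =
      ∑ U with i ∈ U, fourier (slice S c U) x ^ 2 := by
  simp only [onCube_restrict_assignOn hp, influence_fourier, restrictCoeff_sq]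

theorem unifE_restrict {p : MvPolynomial (Fin n) ℝ} {c : Finset (Fin n) → ℝ}
    (hp : onCube p = fourier c) (S : Finset (Fin n)) (x : Cube n) :
    unifE (onCube (restrict p (assignOn S x))) = fourier (slice S c ∅) x := by
  rw [onCube_restrict_assignOn hp, unifE_fourier, ← restrictCoeff_mul_chi, chi_empty, mul_one]

theorem influence_restrict_of_mem {p : MvPolynomial (Fin n) ℝ} {c : Finset (Fin n) → ℝ}
    (hp : onCube p = fourier c) {S : Finset (Fin n)} (x : Cube n) {i : Fin n} (hi : i ∈ S) :
    influence i (onCube (restrict p (assignOn S x))) = 0 := by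
  rw [influence_restrict hp]
  refine Finset.sum_eq_zero fun U hU => ?_
  have hU' := (Finset.mem_filter.1 hU).2
  have : ∀ T, slice S c U T = 0 := by
    intro T
    refine if_neg ?_
    rintro rfl
    exact (Finset.mem_sdiff.1 hU').2 hi
  simp [fourier, this]

/-! ### Total influence outside a set of coordinates -/

theorem sum_influence_compl (S : Finset (Fin n)) (c : Finset (Fin n) → ℝ) :
    ∑ i ∈ Sᶜ, ∑ T with i ∈ T, c T ^ 2 = ∑ T, (T \ S).card * c T ^ 2 := by
  simp only [Finset.sum_filter]
  rw [Finset.sum_comm]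
  refine Finset.sum_congr rfl fun T _ => ?_
  rw [← Finset.sum_filter, Finset.sum_const, nsmul_eq_mul]
  congr 3
  ext i
  simp [and_comm]

theorem sum_influence_compl_le {d : ℕ} {c : Finset (Fin n) → ℝ}
    (hc : ∀ T, c T ≠ 0 → T.card ≤ d) (S : Finset (Fin n)) :
    ∑ i ∈ Sᶜ, ∑ T with i ∈ T, c T ^ 2 ≤ d * ∑ T with T \ S ≠ ∅, c T ^ 2 := by
  rw [sum_influence_compl, Finset.mul_sum, Finset.sum_filter]
  refine Finset.sum_le_sum fun T _ => ?_
  by_cases h0 : c T = 0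
  · simp [h0]
  split_ifs with h
  · gcongr
    exact (Finset.card_le_card Finset.sdiff_subset).trans (hc T h0)
  · simp [not_not.1 h]

theorem le_sum_influence_compl (c : Finset (Fin n) → ℝ) (S : Finset (Fin n)) :
    ∑ T with T \ S ≠ ∅, c T ^ 2 ≤ ∑ i ∈ Sᶜ, ∑ T with i ∈ T, c T ^ 2 := by
  rw [sum_influence_compl, Finset.sum_filter]
  refine Finset.sum_le_sum fun T _ => ?_
  split_ifs with h
  · have : (1 : ℝ) ≤ (T \ S).card := by
      exact_mod_cast Finset.card_pos.2 (Finset.nonempty_iff_ne_empty.2 h)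
    nlinarith [sq_nonneg (c T)]
  · positivity

/-- Adding coordinates greedily, as long as one of the remaining ones carries more than a fraction
`θ` of the remaining weight, makes the remaining weight decay geometrically. -/
theorem exists_greedy_finset (a : Fin n → ℝ) {θ : ℝ} (hθ : θ ≤ 1) (m : ℕ) :
    ∃ S : Finset (Fin n), S.card ≤ m ∧ ((∀ i ∉ S, a i ≤ θ * ∑ j ∈ Sᶜ, a j) ∨
      ∑ j ∈ Sᶜ, a j ≤ (1 - θ) ^ m * ∑ j, a j) := by
  induction m with
  | zero => exact ⟨∅, by simp, Or.inr (by simp)⟩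
  | succ m ih =>
    obtain ⟨S, hS, h | h⟩ := ih
    · exact ⟨S, by omega, Or.inl h⟩
    · by_cases hcrit : ∀ i ∉ S, a i ≤ θ * ∑ j ∈ Sᶜ, a j
      · exact ⟨S, by omega, Or.inl hcrit⟩
      · push Not at hcrit
        obtain ⟨i, hi, hlt⟩ := hcrit
        refine ⟨insert i S, (Finset.card_insert_le _ _).trans (by omega), Or.inr ?_⟩
        have e : ∑ j ∈ Sᶜ, a j = a i + ∑ j ∈ (insert i S)ᶜ, a j := by
          rw [Finset.compl_insert, Finset.add_sum_erase _ _ (Finset.mem_compl.2 hi)]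
        calc ∑ j ∈ (insert i S)ᶜ, a j ≤ (1 - θ) * ∑ j ∈ Sᶜ, a j := by linarith
          _ ≤ (1 - θ) * ((1 - θ) ^ m * ∑ j, a j) := by
            gcongr
          _ = _ := by ring

/-! ### Restrictions that are regular -/

/-- The weight that a random restriction of `S` puts on the coefficients satisfying `P` is at least
half its mean with probability `2^{-O(d)}`, by Paley–Zygmund and hypercontractivity. -/
theorem unifPr_half_mean_le {d : ℕ} {c : Finset (Fin n) → ℝ}
    (hc : ∀ T, c T ≠ 0 → T.card ≤ d) (S : Finset (Fin n))
    (P : Finset (Fin n) → Prop) [DecidablePred P] :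
    1 / (4 * (81 : ℝ) ^ d) ≤ unifPr (fun x : Cube n =>
      (∑ T with P (T \ S), c T ^ 2) / 2 ≤ ∑ U with P U, fourier (slice S c U) x ^ 2) := by
  have h := paley_zygmund_half (B := (81 : ℝ) ^ d)
    (f := fun x : Cube n => ∑ U with P U, fourier (slice S c U) x ^ 2)
    (fun x => Finset.sum_nonneg fun U _ => sq_nonneg _) (one_le_pow₀ (by norm_num)) (by
      refine (unifE_sum_sq_pow_le _ two_ne_zero fun U T hT => hc T (slice_ne_zero hT)).trans_eq ?_
      rw [mul_pow, ← pow_mul, mul_comm d 2, pow_mul]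
      norm_num)
  rwa [unifE_sum_slice_sq] at h

/-- If every influence outside `S` is a small fraction of their total, then a random restriction
of `S` is regular with probability `2^{-O(d)}`: the variance of the restriction is comparable to
its mean with such a probability, and a union bound over `k`-th moments controls the influences. -/
theorem unifPr_isRegular_restrict {d k : ℕ} (hd : d ≠ 0) (hk : 2 ≤ k) {τ : ℝ} (hτ : 0 < τ)
    (hτk : τ⁻¹ ≤ 3 ^ k) {p : MvPolynomial (Fin n) ℝ} {c : Finset (Fin n) → ℝ}
    (hc : ∀ T, c T ≠ 0 → T.card ≤ d) (hp : onCube p = fourier c) (S : Finset (Fin n))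
    (hS : ∀ i ∉ S, ∑ T with i ∈ T, c T ^ 2 ≤
      τ / (288 * d ^ 2 * (81 * (4 * k + 1) ^ 2) ^ d) * ∑ j ∈ Sᶜ, ∑ T with j ∈ T, c T ^ 2) :
    1 / (8 * (81 : ℝ) ^ d) ≤
      unifPr (fun x => IsRegular τ (restrict p (assignOn S x))) := by
  have hk0 : k ≠ 0 := by omega
  have hd0 : (0 : ℝ) < d := by exact_mod_cast Nat.pos_of_ne_zero hd
  have hd1 : (1 : ℝ) ≤ d := by exact_mod_cast Nat.one_le_iff_ne_zero.2 hd
  have hq : (0 : ℝ) < 81 ^ d := by positivity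
  have hq1 : (1 : ℝ) ≤ 81 ^ d := one_le_pow₀ (by norm_num)
  obtain ⟨V, hV⟩ : ∃ V : Cube n → ℝ, V = fun x => ∑ U with U ≠ ∅, fourier (slice S c U) x ^ 2 :=
    ⟨_, rfl⟩
  obtain ⟨J, hJ⟩ : ∃ J : Fin n → Cube n → ℝ,
      J = fun i x => ∑ U with i ∈ U, fourier (slice S c U) x ^ 2 := ⟨_, rfl⟩
  obtain ⟨a, ha⟩ : ∃ a : Fin n → ℝ, a = fun i => ∑ T with i ∈ T, c T ^ 2 := ⟨_, rfl⟩
  obtain ⟨m, hm⟩ : ∃ m, m = ∑ T with T \ S ≠ ∅, c T ^ 2 := ⟨_, rfl⟩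
  obtain ⟨A, hA⟩ : ∃ A, A = ∑ j ∈ Sᶜ, ∑ T with j ∈ T, c T ^ 2 := ⟨_, rfl⟩
  have ha0 : ∀ i, 0 ≤ a i := fun i => by
    rw [ha]
    exact Finset.sum_nonneg fun T _ => sq_nonneg _
  have hJ0 : ∀ i x, 0 ≤ J i x := fun i x => by
    rw [hJ]
    exact Finset.sum_nonneg fun U _ => sq_nonneg _
  have hJV : ∀ i x, J i x ≤ V x := by
    intro i x
    rw [hJ, hV]
    refine Finset.sum_le_sum_of_subset_of_nonneg (fun U hU => ?_) fun U _ _ => sq_nonneg _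
    have hU' := (Finset.mem_filter.1 hU).2
    simp [Finset.ne_empty_of_mem hU']
  have hreg : ∀ x, IsRegular τ (restrict p (assignOn S x)) ↔ ∀ i, i ∉ S → J i x ≤ τ * V x := by
    intro x
    rw [IsRegular]
    refine forall_congr' fun i => ?_
    by_cases hi : i ∈ S
    · rw [influence_restrict_of_mem hp x hi, unifVar_restrict hp]
      simp only [hi, not_true_eq_false, false_imp_iff, iff_true]
      exact mul_nonneg hτ.le (Finset.sum_nonneg fun U _ => sq_nonneg _)
    · simp only [influence_restrict hp, unifVar_restrict hp, hV, hJ, hi, not_false_eq_true,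
        forall_const]
  have hEV : unifE V = m := by rw [hV, hm, unifE_sum_slice_sq S c (fun U => U ≠ ∅)]
  have hEJ : ∀ i ∉ S, unifE (J i) = a i := by
    intro i hi
    rw [hJ, ha]
    refine (unifE_sum_slice_sq S c (fun U => i ∈ U)).trans ?_
    simp [hi]
  have hAm : A ≤ d * m := by
    rw [hA, hm]
    exact sum_influence_compl_le hc S
  have hmA : m ≤ A := by
    rw [hA, hm]
    exact le_sum_influence_compl c S
  have hm0 : 0 ≤ m := by
    rw [hm]
    exact Finset.sum_nonneg fun T _ => sq_nonneg _
  have hV0 : ∀ x, 0 ≤ V x := fun x => by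
    rw [hV]
    exact Finset.sum_nonneg fun U _ => sq_nonneg _
  rcases hm0.eq_or_lt with h0 | hmpos
  · -- The restrictions are then all constant, and the normalization by `m` below is unavailable.
    rw [unifPr_eq_one]
    · rw [div_le_one (by positivity)]
      linarith
    · intro x
      have hVx : V x = 0 := eq_zero_of_unifE_nonpos hV0 (by rw [hEV, ← h0]) x
      rw [hreg]
      intro i _
      have := hJV i x
      rw [hVx] at this ⊢
      simpa using this
  · have hApos : 0 < A := hmpos.trans_le hmA
    obtain ⟨D, hD⟩ : ∃ D : ℝ, D = 2 * d * (4 * k + 1) ^ d := ⟨_, rfl⟩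
    obtain ⟨B, hB⟩ : ∃ B : ℝ, B = 72 * D * 81 ^ d := ⟨_, rfl⟩
    have hC1 : (1 : ℝ) ≤ (4 * k + 1) ^ d :=
      one_le_pow₀ (by linarith [(Nat.cast_nonneg k : (0 : ℝ) ≤ k)])
    have hD1 : 1 ≤ D := by
      rw [hD]
      nlinarith
    have hB3 : 3 ≤ B := by
      rw [hB]
      nlinarith
    have hDB : (288 * d ^ 2 * (81 * (4 * k + 1) ^ 2) ^ d : ℝ) = D * B := by
      rw [hB, hD, mul_pow, ← pow_mul, mul_comm 2 d, pow_mul]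
      ring
    have hy : ∀ i ∉ S, D * a i / (τ * A) ≤ 1 / B := by
      intro i hi
      have h := hS i hi
      rw [hDB, ← hA] at h
      rw [div_le_div_iff₀ (by positivity) (by linarith)]
      have h' : a i ≤ τ / (D * B) * A := by
        rw [ha]
        exact h
      calc D * a i * B ≤ D * (τ / (D * B) * A) * B := by
            gcongr
        _ = 1 * (τ * A) := by
            field_simp
    -- The influences are at most `τ m / 2` except with small probability, by the `k`-th moments.
    have hmom : ∀ i ∈ Sᶜ, unifE (fun x => (J i x / (τ * m / 2)) ^ k) ≤
        (D * a i / (τ * A)) * (1 / B) ^ (k - 1) := by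
      intro i hi
      have hi := Finset.mem_compl.1 hi
      have h1 : unifE (fun x => J i x ^ k) ≤ ((4 * k + 1 : ℝ) ^ d * a i) ^ k := by
        have h := unifE_sum_sq_pow_le (Finset.univ.filter fun U => i ∈ U) (c := slice S c) hk0
          fun U T hT => hc T (slice_ne_zero hT)
        have e := hEJ i hi
        rw [hJ] at e ⊢
        rwa [e] at h
      have hy0 : 0 ≤ D * a i / (τ * A) := by
        have := ha0 i
        positivity
      calc unifE (fun x => (J i x / (τ * m / 2)) ^ k)
          = ((τ * m / 2) ^ k)⁻¹ * unifE (fun x => J i x ^ k) := by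
            rw [← unifE_const_mul]
            congr 1
            ext x
            rw [div_pow, div_eq_inv_mul]
        _ ≤ ((τ * m / 2) ^ k)⁻¹ * ((4 * k + 1 : ℝ) ^ d * a i) ^ k := by gcongr
        _ = ((4 * k + 1 : ℝ) ^ d * a i / (τ * m / 2)) ^ k := by
            rw [div_pow ((4 * k + 1 : ℝ) ^ d * a i),
              div_eq_inv_mul (((4 * k + 1 : ℝ) ^ d * a i) ^ k)]
        _ ≤ (D * a i / (τ * A)) ^ k := by
            have hai := ha0 i
            gcongr ?_ ^ k
            rw [div_le_div_iff₀ (by positivity) (by positivity), hD]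
            calc (4 * k + 1 : ℝ) ^ d * a i * (τ * A)
                ≤ (4 * k + 1 : ℝ) ^ d * a i * (τ * (d * m)) := by gcongr
              _ = _ := by ring
        _ = (D * a i / (τ * A)) * (D * a i / (τ * A)) ^ (k - 1) := by
            rw [← pow_succ', Nat.sub_add_cancel (by omega)]
        _ ≤ _ := mul_le_mul_of_nonneg_left (pow_le_pow_left₀ hy0 (hy i hi) _) hy0
    have hbad : unifPr (fun x => (1 : ℝ) ≤ ∑ i ∈ Sᶜ, (J i x / (τ * m / 2)) ^ k) ≤
        1 / (8 * 81 ^ d) := by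
      have hpos : ∀ i x, 0 ≤ (J i x / (τ * m / 2)) ^ k := fun i x =>
        pow_nonneg (div_nonneg (hJ0 i x) (by positivity)) k
      refine (unifPr_le_unifE_div one_pos (fun x => Finset.sum_nonneg fun i _ => hpos i x)
        fun x hx => hx).trans ?_
      rw [div_one, unifE_sum]
      have hsum : ∑ i ∈ Sᶜ, D * a i / (τ * A) = D / τ := by
        rw [← Finset.sum_div, ← Finset.mul_sum]
        have : ∑ i ∈ Sᶜ, a i = A := by rw [ha, hA]
        rw [this]
        field_simp
      calc _ ≤ ∑ i ∈ Sᶜ, (D * a i / (τ * A)) * (1 / B) ^ (k - 1) := Finset.sum_le_sum hmom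
        _ = D * τ⁻¹ * (1 / B) ^ (k - 1) := by
            rw [← Finset.sum_mul, hsum, div_eq_mul_inv]
        _ ≤ D * 3 ^ k * (1 / B) ^ (k - 1) := by gcongr
        _ = 3 * D * (3 / B) ^ (k - 1) := by
            obtain ⟨j, rfl⟩ : ∃ j, k = j + 1 := ⟨k - 1, by omega⟩
            rw [Nat.add_sub_cancel, div_pow, div_pow, pow_succ]
            ring
        _ ≤ 3 * D * (3 / B) ^ 1 := by
            gcongr ?_ * ?_
            exact pow_le_pow_of_le_one (by positivity) ((div_le_one (by linarith)).2 hB3)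
              (by omega)
        _ = 1 / (8 * 81 ^ d) := by
            rw [hB]
            field_simp
            norm_num
    have hgood := unifPr_half_mean_le hc S (fun U => U ≠ ∅)
    have himp : ∀ x : Cube n, (∑ T with T \ S ≠ ∅, c T ^ 2) / 2 ≤
        ∑ U with U ≠ ∅, fourier (slice S c U) x ^ 2 →
        IsRegular τ (restrict p (assignOn S x)) ∨
          (1 : ℝ) ≤ ∑ i ∈ Sᶜ, (J i x / (τ * m / 2)) ^ k := by
      intro x hx
      by_contra! hcon
      obtain ⟨h1, h2⟩ := hcon
      rw [hreg] at h1
      push Not at h1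
      obtain ⟨i, hi, hlt⟩ := h1
      have hx' : m / 2 ≤ V x := by
        rw [hm, hV]
        exact hx
      have h3 : (1 : ℝ) ≤ (J i x / (τ * m / 2)) ^ k := by
        refine one_le_pow₀ ((one_le_div (by positivity)).2 ?_)
        nlinarith
      have h4 : (J i x / (τ * m / 2)) ^ k ≤ ∑ i ∈ Sᶜ, (J i x / (τ * m / 2)) ^ k :=
        Finset.single_le_sum (f := fun i => (J i x / (τ * m / 2)) ^ k)
          (fun i _ => pow_nonneg (div_nonneg (hJ0 i x) (by positivity)) k)
          (Finset.mem_compl.2 hi)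
      linarith
    have hfin := unifPr_le_add_of_imp himp
    have e : 1 / (4 * (81 : ℝ) ^ d) = 1 / (8 * 81 ^ d) + 1 / (8 * 81 ^ d) := by
      field_simp
      norm_num
    linarith

/-! ### Restrictions of nearly constant sign -/

/-- Chebyshev's inequality for signs: a mean large against the standard deviation fixes the
sign. -/
theorem hasConstantSign_of_unifVar_le {ε : ℝ} {q : MvPolynomial (Fin n) ℝ}
    (h0 : unifE (onCube q) ≠ 0) (h : unifVar (onCube q) ≤ ε * unifE (onCube q) ^ 2) :
    HasConstantSign ε q := by
  obtain ⟨μ, hμ⟩ : ∃ μ, μ = unifE (onCube q) := ⟨_, rfl⟩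
  rw [← hμ] at h0 h
  have hμ2 : 0 < μ ^ 2 := by positivity
  refine ⟨SignType.sign μ, by simpa using h0, ?_⟩
  have h1 : unifPr (fun x => ¬ threshold q x = SignType.sign μ) ≤ ε := by
    refine (unifPr_le_unifE_div (f := fun x => (onCube q x - μ) ^ 2) hμ2
      (fun x => sq_nonneg _) ?_).trans ?_
    · intro x hx
      by_contra! hlt
      apply hx
      unfold threshold
      have h2 := sq_lt_sq.1 hlt
      rcases lt_or_gt_of_ne h0 with hn | hp
      · rw [abs_of_neg hn, abs_lt] at h2
        rw [sign_neg hn, sign_neg (by linarith)]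
      · rw [abs_of_pos hp, abs_lt] at h2
        rw [sign_pos hp, sign_pos (by linarith)]
    · rw [div_le_iff₀ hμ2]
      unfold unifVar at h
      rwa [← hμ] at h
  have h3 : unifPr (fun _ : Cube n => True) ≤ unifPr (fun x => threshold q x = SignType.sign μ) +
      unifPr (fun x => ¬ threshold q x = SignType.sign μ) :=
    unifPr_le_add_of_imp fun x _ => em _
  rw [unifPr_eq_one (fun _ => trivial)] at h3
  linarith

/-- If the influences outside `S` are a tiny part of the total influence, then the mean of a
random restriction of `S` dominates its standard deviation with probability `2^{-O(d)}`. -/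
theorem unifPr_hasConstantSign_restrict {d : ℕ} (hd : d ≠ 0) {ε η : ℝ} (hε : 0 < ε) (hε1 : ε ≤ 1)
    (hη : η ≤ ε / (32 * 81 ^ d * d)) {p : MvPolynomial (Fin n) ℝ} {c : Finset (Fin n) → ℝ}
    (hc : ∀ T, c T ≠ 0 → T.card ≤ d) (hp : onCube p = fourier c)
    (hpos : 0 < ∑ T with T ≠ ∅, c T ^ 2) (S : Finset (Fin n))
    (hS : ∑ j ∈ Sᶜ, ∑ T with j ∈ T, c T ^ 2 ≤ η * ∑ j, ∑ T with j ∈ T, c T ^ 2) :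
    1 / (8 * (81 : ℝ) ^ d) ≤
      unifPr (fun x => HasConstantSign ε (restrict p (assignOn S x))) := by
  have hd0 : (0 : ℝ) < d := by exact_mod_cast Nat.pos_of_ne_zero hd
  have hq : (0 : ℝ) < 81 ^ d := by positivity
  have hq1 : (1 : ℝ) ≤ 81 ^ d := one_le_pow₀ (by norm_num)
  obtain ⟨W, hW⟩ : ∃ W, W = ∑ T with T ≠ ∅, c T ^ 2 := ⟨_, rfl⟩
  obtain ⟨m, hm⟩ : ∃ m, m = ∑ T with T \ S ≠ ∅, c T ^ 2 := ⟨_, rfl⟩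
  rw [← hW] at hpos
  have htot0 : 0 ≤ ∑ j, ∑ T with j ∈ T, c T ^ 2 :=
    Finset.sum_nonneg fun j _ => Finset.sum_nonneg fun T _ => sq_nonneg _
  have htot : ∑ j, ∑ T with j ∈ T, c T ^ 2 ≤ d * W := by
    have := sum_influence_compl_le hc ∅
    simpa [hW] using this
  have hmW : m ≤ ε / (32 * 81 ^ d) * W := by
    calc m ≤ ∑ j ∈ Sᶜ, ∑ T with j ∈ T, c T ^ 2 := by
          rw [hm]
          exact le_sum_influence_compl c S
      _ ≤ η * ∑ j, ∑ T with j ∈ T, c T ^ 2 := hS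
      _ ≤ ε / (32 * 81 ^ d * d) * ∑ j, ∑ T with j ∈ T, c T ^ 2 := by gcongr
      _ ≤ ε / (32 * 81 ^ d * d) * (d * W) := by gcongr
      _ = _ := by field_simp
  have hmW2 : m ≤ W / 2 := by
    have : ε / (32 * 81 ^ d) ≤ 1 / 2 := by
      rw [div_le_div_iff₀ (by positivity) (by norm_num)]
      linarith
    calc m ≤ ε / (32 * 81 ^ d) * W := hmW
      _ ≤ 1 / 2 * W := by gcongr
      _ = W / 2 := by ring
  have hmean : W / 2 ≤ ∑ T with T \ S = ∅, c T ^ 2 := by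
    have h1 : W ≤ ∑ T, c T ^ 2 := by
      rw [hW]
      exact Finset.sum_le_sum_of_subset_of_nonneg (Finset.filter_subset _ _)
        fun T _ _ => sq_nonneg _
    have h2 := Finset.sum_filter_add_sum_filter_not Finset.univ
      (fun T : Finset (Fin n) => T \ S = ∅) (fun T => c T ^ 2)
    have h3 : m = ∑ T with ¬ T \ S = ∅, c T ^ 2 := hm
    linarith
  have hgood := unifPr_half_mean_le hc S (fun U => U = ∅)
  have hbad : unifPr (fun x : Cube n =>
      ε * W / 4 ≤ ∑ U with U ≠ ∅, fourier (slice S c U) x ^ 2) ≤ 1 / (8 * 81 ^ d) := by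
    refine (unifPr_le_unifE_div (by positivity)
      (fun x => Finset.sum_nonneg fun U _ => sq_nonneg _) fun x hx => hx).trans ?_
    rw [unifE_sum_slice_sq S c (fun U => U ≠ ∅), ← hm, div_le_iff₀ (by positivity)]
    refine hmW.trans_eq ?_
    field_simp
    norm_num
  have himp : ∀ x : Cube n, (∑ T with T \ S = ∅, c T ^ 2) / 2 ≤
      ∑ U with U = ∅, fourier (slice S c U) x ^ 2 →
      HasConstantSign ε (restrict p (assignOn S x)) ∨
        ε * W / 4 ≤ ∑ U with U ≠ ∅, fourier (slice S c U) x ^ 2 := by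
    intro x hx
    rw [Finset.filter_eq' Finset.univ (∅ : Finset (Fin n)), if_pos (Finset.mem_univ _),
      Finset.sum_singleton] at hx
    by_cases hV : ε * W / 4 ≤ ∑ U with U ≠ ∅, fourier (slice S c U) x ^ 2
    · exact Or.inr hV
    · left
      have hμ : W / 4 ≤ fourier (slice S c ∅) x ^ 2 := by linarith
      refine hasConstantSign_of_unifVar_le ?_ ?_
      · rw [unifE_restrict hp]
        intro h0
        rw [h0] at hμ
        linarith
      · rw [unifE_restrict hp, unifVar_restrict hp]
        have : ε * (W / 4) ≤ ε * fourier (slice S c ∅) x ^ 2 := by gcongr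
        linarith
  have hfin := unifPr_le_add_of_imp himp
  have e : 1 / (4 * (81 : ℝ) ^ d) = 1 / (8 * 81 ^ d) + 1 / (8 * 81 ^ d) := by
    field_simp
    norm_num
  linarith

/-! ### The dichotomy -/

theorem isRegular_of_totalDegree_eq_zero {τ : ℝ} (hτ : 0 ≤ τ) {p : MvPolynomial (Fin n) ℝ}
    (hp : p.totalDegree = 0) : IsRegular τ p := by
  obtain ⟨c, hc, hpc⟩ := exists_onCube_eq_fourier p hp.le
  intro i
  rw [hpc, influence_fourier, unifVar_fourier]
  rw [Finset.sum_eq_zero]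
  · exact mul_nonneg hτ (Finset.sum_nonneg fun T _ => sq_nonneg _)
  · intro T hT
    by_contra h
    have h1 := hc T fun h0 => h (by simp [h0])
    have h2 := Finset.card_pos.2 ⟨i, (Finset.mem_filter.1 hT).2⟩
    omega

/-- The dichotomy: the greedy choice of `S` either stops at a set outside which all influences are
small, or leaves a negligible part of the total influence. -/
theorem exists_good_restriction {d k m : ℕ} (hd : d ≠ 0) (hk : 2 ≤ k) {τ ε : ℝ} (hτ : 0 < τ)
    (hτ1 : τ ≤ 1) (hτk : τ⁻¹ ≤ 3 ^ k) (hε : 0 < ε) (hε1 : ε ≤ 1)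
    (hm : (1 - τ / (288 * d ^ 2 * (81 * (4 * k + 1) ^ 2) ^ d)) ^ m ≤ ε / (32 * 81 ^ d * d))
    (p : MvPolynomial (Fin n) ℝ) (hp : p.totalDegree ≤ d) :
    ∃ S : Finset (Fin n), S.card ≤ m ∧ 1 / (8 * (81 : ℝ) ^ d) ≤ unifPr (fun x : Cube n =>
      IsRegular τ (restrict p (assignOn S x)) ∨
        HasConstantSign ε (restrict p (assignOn S x))) := by
  obtain ⟨c, hc, hpc⟩ := exists_onCube_eq_fourier p hp
  have hd1 : (1 : ℝ) ≤ d := by exact_mod_cast Nat.one_le_iff_ne_zero.2 hd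
  have hθ : τ / (288 * d ^ 2 * (81 * (4 * k + 1) ^ 2) ^ d) ≤ 1 := by
    have hk1 : (1 : ℝ) ≤ 4 * k + 1 := by linarith [(Nat.cast_nonneg k : (0 : ℝ) ≤ k)]
    have h1 : (1 : ℝ) ≤ (81 * (4 * k + 1) ^ 2) ^ d := one_le_pow₀ (by nlinarith)
    rw [div_le_one (by positivity)]
    nlinarith [one_le_pow₀ hd1 (n := 2)]
  obtain ⟨S, hS, h | h⟩ := exists_greedy_finset (fun i => ∑ T with i ∈ T, c T ^ 2) hθ m
  · refine ⟨S, hS, (unifPr_isRegular_restrict hd hk hτ hτk hc hpc S h).trans ?_⟩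
    exact unifPr_mono fun x => Or.inl
  · have hW : 0 ≤ ∑ T with T ≠ ∅, c T ^ 2 := Finset.sum_nonneg fun T _ => sq_nonneg _
    rcases hW.eq_or_lt with h0 | hpos
    · -- A polynomial of variance zero satisfies the hypothesis of the regular case trivially.
      have hz : ∀ i : Fin n, ∑ T with i ∈ T, c T ^ 2 = 0 := by
        intro i
        refine Finset.sum_eq_zero fun T hT => ?_
        refine (Finset.sum_eq_zero_iff_of_nonneg fun T _ => sq_nonneg _).1 h0.symm T ?_
        simp [Finset.ne_empty_of_mem (Finset.mem_filter.1 hT).2]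
      refine ⟨S, hS, (unifPr_isRegular_restrict hd hk hτ hτk hc hpc S ?_).trans ?_⟩
      · simp [hz]
      · exact unifPr_mono fun x => Or.inl
    · refine ⟨S, hS, (unifPr_hasConstantSign_restrict hd hε hε1 hm hc hpc hpos S h).trans ?_⟩
      exact unifPr_mono fun x => Or.inr

/-! ### Estimates of the parameters -/

theorem four_thirds_le_log_inv {τ : ℝ} (hτ : 0 < τ) (hτ1 : τ < 1 / 4) :
    4 / 3 ≤ Real.log τ⁻¹ := by
  have h4 : (4 : ℝ) ≤ τ⁻¹ := by
    rw [le_inv_comm₀ (by norm_num) hτ]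
    linarith
  have h : Real.log 4 ≤ Real.log τ⁻¹ := Real.log_le_log (by norm_num) h4
  have h2 : Real.log 4 = 2 * Real.log 2 := by
    rw [show (4 : ℝ) = 2 ^ 2 by norm_num, Real.log_pow]
    norm_num
  linarith [Real.log_two_gt_d9]

theorem two_le_mul_log_mul_log_sq {d : ℕ} (hd : d ≠ 0) {l e : ℝ} (hl : 4 / 3 ≤ l)
    (he : 4 / 3 ≤ e) : 2 ≤ ((d : ℝ) * l * e) ^ 2 := by
  have hd1 : (1 : ℝ) ≤ d := by exact_mod_cast Nat.one_le_iff_ne_zero.2 hd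
  have h1 : 4 / 3 ≤ (d : ℝ) * l := by nlinarith
  have h2 : 16 / 9 ≤ (d : ℝ) * l * e := by nlinarith
  nlinarith

theorem one_sub_pow_le {x y : ℝ} {m : ℕ} (hx : x ≤ 1) (hy : 0 < y) (h : Real.log y⁻¹ ≤ m * x) :
    (1 - x) ^ m ≤ y := by
  calc (1 - x) ^ m ≤ Real.exp (-x) ^ m := by
        gcongr
        exact Real.one_sub_le_exp_neg _
    _ = Real.exp (-(m * x)) := by
        rw [← Real.exp_nat_mul]
        ring_nf
    _ ≤ Real.exp (-Real.log y⁻¹) := Real.exp_le_exp.2 (neg_le_neg h)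
    _ = y := by rw [Real.log_inv, neg_neg, Real.exp_log hy]

theorem two_pow_le_pow {M : ℝ} (hM2 : 2 ≤ M ^ 2) (j : ℕ) : (2 : ℝ) ^ j ≤ M ^ (2 * j) := by
  rw [pow_mul]
  gcongr

/-- The factor by which the fraction in the greedy choice has to be smaller than `τ`, when `M` is
the base of the bound on the size of the restricted set. -/
theorem regularity_loss_le {d k : ℕ} {M : ℝ} (hM1 : 1 ≤ M) (hM2 : 2 ≤ M ^ 2) (hd : d ≤ M)
    (hk : (4 * k + 1 : ℝ) ≤ 8 * M) :
    (288 * d ^ 2 * (81 * (4 * k + 1) ^ 2) ^ d : ℝ) ≤ M ^ (20 + 28 * d) := by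
  have h2 : (81 * (4 * k + 1) ^ 2 : ℝ) ≤ M ^ 28 := by
    calc (81 * (4 * k + 1) ^ 2 : ℝ) ≤ 81 * (8 * M) ^ 2 := by gcongr
      _ = 5184 * M ^ 2 := by ring
      _ ≤ 2 ^ 13 * M ^ 2 := by
        gcongr
        norm_num
      _ ≤ M ^ (2 * 13) * M ^ 2 := by
        gcongr
        exact two_pow_le_pow hM2 13
      _ = M ^ 28 := by ring
  have h3 : (288 * d ^ 2 : ℝ) ≤ M ^ 20 := by
    calc (288 * d ^ 2 : ℝ) ≤ 2 ^ 9 * M ^ 2 := by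
          gcongr
          norm_num
      _ ≤ M ^ (2 * 9) * M ^ 2 := by
        gcongr
        exact two_pow_le_pow hM2 9
      _ = M ^ 20 := by ring
  rw [pow_add, pow_mul]
  gcongr

/-- The factor by which the influences left outside the restricted set have to be smaller than the
fraction `ε` of the total influence. -/
theorem sign_loss_le {d : ℕ} {M : ℝ} (hM1 : 1 ≤ M) (hM2 : 2 ≤ M ^ 2) (hd : d ≤ M) :
    (32 * 81 ^ d * d : ℝ) ≤ M ^ (11 + 14 * d) := by
  have h1 : (32 : ℝ) ≤ M ^ 10 := le_trans (by norm_num) (two_pow_le_pow hM2 5)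
  have h2 : (81 : ℝ) ≤ M ^ 14 := le_trans (by norm_num) (two_pow_le_pow hM2 7)
  calc (32 * 81 ^ d * d : ℝ) ≤ M ^ 10 * (M ^ 14) ^ d * M := by gcongr
    _ = M ^ (11 + 14 * d) := by
      rw [← pow_mul]
      ring

theorem eight_mul_pow_le {d : ℕ} (hd : d ≠ 0) : 8 * (81 : ℝ) ^ d ≤ 2 ^ (77 * d) := by
  calc 8 * (81 : ℝ) ^ d ≤ 8 ^ d * 81 ^ d := by
        gcongr
        exact le_self_pow₀ (by norm_num) hd
    _ = 648 ^ d := by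
        rw [← mul_pow]
        norm_num
    _ ≤ (2 ^ 77) ^ d := by
        gcongr
        norm_num
    _ = 2 ^ (77 * d) := by rw [← pow_mul]

/-- The size of the restricted set: `t` stands for `τ⁻¹`, and `R` and `N` for the factors lost in
the regular and in the constant-sign case. -/
theorem ceil_mul_log_le {d : ℕ} (hd : d ≠ 0) {M t R N ε : ℝ} (hM1 : 1 ≤ M) (hM2 : 2 ≤ M ^ 2)
    (ht : 1 ≤ t) (hR : 0 ≤ R) (hRM : R ≤ M ^ (20 + 28 * d)) (hN : 1 ≤ N)
    (hNM : N ≤ M ^ (11 + 14 * d)) (hε : 0 < ε) (hε1 : ε ≤ 1) (hεM : Real.log ε⁻¹ ≤ M) :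
    (⌈t * R * Real.log (N / ε)⌉₊ : ℝ) ≤ t * M ^ (77 * d) := by
  have hlogN : Real.log (N / ε) ≤ 2 * M ^ (11 + 14 * d) := by
    rw [div_eq_mul_inv, Real.log_mul (by positivity) (inv_pos.2 hε).ne']
    have h1 : Real.log N ≤ N := (Real.log_le_sub_one_of_pos (by positivity)).trans (by linarith)
    have h2 : M ≤ M ^ (11 + 14 * d) := le_self_pow₀ hM1 (by omega)
    linarith
  have hlog0 : 0 ≤ Real.log (N / ε) :=
    Real.log_nonneg ((one_le_div hε).2 (hε1.trans hN))
  have h1 : (⌈t * R * Real.log (N / ε)⌉₊ : ℝ) ≤ t * R * Real.log (N / ε) + 1 :=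
    (Nat.ceil_lt_add_one (by positivity)).le
  have h2 : 1 ≤ t * (M ^ (20 + 28 * d) * M ^ (11 + 14 * d)) :=
    one_le_mul_of_one_le_of_one_le ht (one_le_mul_of_one_le_of_one_le
      (one_le_pow₀ hM1) (one_le_pow₀ hM1))
  have h3 : (3 : ℝ) ≤ M ^ 4 := le_trans (by norm_num) (two_pow_le_pow hM2 2)
  calc _ ≤ t * R * Real.log (N / ε) + 1 := h1
    _ ≤ t * M ^ (20 + 28 * d) * (2 * M ^ (11 + 14 * d)) +
        t * (M ^ (20 + 28 * d) * M ^ (11 + 14 * d)) := by gcongr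
    _ = t * (3 * (M ^ (20 + 28 * d) * M ^ (11 + 14 * d))) := by ring
    _ ≤ t * (M ^ 4 * (M ^ (20 + 28 * d) * M ^ (11 + 14 * d))) := by gcongr
    _ = t * M ^ (4 + ((20 + 28 * d) + (11 + 14 * d))) := by
      rw [pow_add M 4, pow_add M (20 + 28 * d)]
    _ ≤ t * M ^ (77 * d) := by
      gcongr ?_ * ?_
      exact pow_le_pow_right₀ hM1 (by omega)

/-! ### The one-step restriction -/

theorem exists_one_step_restriction {n d : ℕ} (p : MvPolynomial (Fin n) ℝ)
    (hp : p.totalDegree ≤ d) {τ ε : ℝ} (hτ : 0 < τ) (hτ1 : τ < 1 / 4) (hε : 0 < ε)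
    (hε1 : ε < 1 / 4) :
    ∃ S : Finset (Fin n),
      (S.card : ℝ) ≤ τ⁻¹ * ((d : ℝ) * Real.log τ⁻¹ * Real.log ε⁻¹) ^ (77 * d) ∧
      ((2 : ℝ) ^ (77 * d))⁻¹ ≤ unifPr (fun x : Cube n =>
        IsRegular τ (restrict p (assignOn S x)) ∨
          HasConstantSign ε (restrict p (assignOn S x))) := by
  rcases eq_or_ne d 0 with rfl | hd
  · refine ⟨∅, ?_, ?_⟩
    · simpa using hτ.le
    · rw [unifPr_eq_one]
      · simp
      · intro x
        exact Or.inl (isRegular_of_totalDegree_eq_zero hτ.le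
          (Nat.le_zero.1 ((totalDegree_restrict_le p _).trans hp)))
  have hl := four_thirds_le_log_inv hτ hτ1
  have he := four_thirds_le_log_inv hε hε1
  have hM2 := two_le_mul_log_mul_log_sq hd hl he
  obtain ⟨l, hl_def⟩ : ∃ l, l = Real.log τ⁻¹ := ⟨_, rfl⟩
  obtain ⟨e, he_def⟩ : ∃ e, e = Real.log ε⁻¹ := ⟨_, rfl⟩
  rw [← hl_def] at hl hM2 ⊢
  rw [← he_def] at he hM2 ⊢
  have hd1 : (1 : ℝ) ≤ d := by exact_mod_cast Nat.one_le_iff_ne_zero.2 hd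
  obtain ⟨M, hM⟩ : ∃ M, M = (d : ℝ) * l * e := ⟨_, rfl⟩
  rw [← hM] at hM2 ⊢
  have hdl : (1 : ℝ) ≤ d * l := by nlinarith
  have hde : (1 : ℝ) ≤ d * e := by nlinarith
  have hle : (1 : ℝ) ≤ l * e := by nlinarith
  have hMd : (d : ℝ) ≤ M := by rw [hM]; nlinarith
  have hMl : l ≤ M := by rw [hM]; nlinarith
  have hMe : e ≤ M := by rw [hM]; nlinarith
  have hM1 : 1 ≤ M := by linarith
  -- The order `k` of the moments is about `log τ⁻¹`.
  obtain ⟨k, hk⟩ : ∃ k, k = ⌈l⌉₊ := ⟨_, rfl⟩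
  have hlk : l ≤ k := by
    rw [hk]
    exact Nat.le_ceil _
  have hkl : (k : ℝ) ≤ l + 1 := by
    rw [hk]
    exact (Nat.ceil_lt_add_one (by linarith)).le
  have hk2 : 2 ≤ k := by
    have : (1 : ℝ) < k := by linarith
    exact_mod_cast this
  have hτk : τ⁻¹ ≤ 3 ^ k := by
    calc τ⁻¹ = Real.exp l := by rw [hl_def, Real.exp_log (inv_pos.2 hτ)]
      _ ≤ Real.exp k := Real.exp_le_exp.2 hlk
      _ = Real.exp 1 ^ k := by rw [← Real.exp_nat_mul, mul_one]
      _ ≤ 3 ^ k := by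
        gcongr
        linarith [Real.exp_one_lt_d9]
  have hk1 : (1 : ℝ) ≤ 4 * k + 1 := by linarith
  have hτi : 1 ≤ τ⁻¹ := (one_le_inv₀ hτ).2 (by linarith)
  obtain ⟨R, hR⟩ : ∃ R : ℝ, R = 288 * d ^ 2 * (81 * (4 * k + 1) ^ 2) ^ d := ⟨_, rfl⟩
  obtain ⟨N, hN⟩ : ∃ N : ℝ, N = 32 * 81 ^ d * d := ⟨_, rfl⟩
  have hR1 : 1 ≤ R := by
    rw [hR]
    exact one_le_mul_of_one_le_of_one_le (by nlinarith) (one_le_pow₀ (by nlinarith))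
  have hN1 : 1 ≤ N := by
    rw [hN]
    exact one_le_mul_of_one_le_of_one_le (one_le_mul_of_one_le_of_one_le (by norm_num)
      (one_le_pow₀ (by norm_num))) hd1
  have hRM : R ≤ M ^ (20 + 28 * d) := hR ▸ regularity_loss_le hM1 hM2 hMd (by linarith)
  have hNM : N ≤ M ^ (11 + 14 * d) := hN ▸ sign_loss_le hM1 hM2 hMd
  have hm1 := ceil_mul_log_le hd hM1 hM2 hτi (by linarith) hRM hN1 hNM hε (by linarith)
    (he_def ▸ hMe)
  have hmθ : (1 - τ / R) ^ ⌈τ⁻¹ * R * Real.log (N / ε)⌉₊ ≤ ε / N := by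
    refine one_sub_pow_le ((div_le_one (by linarith)).2 (by linarith))
      (div_pos hε (by linarith)) ?_
    rw [inv_div]
    have hR0 : 0 < R := by linarith
    calc Real.log (N / ε) = τ⁻¹ * R * Real.log (N / ε) * (τ / R) := by field_simp
      _ ≤ _ := by
        gcongr
        exact Nat.le_ceil _
  obtain ⟨m, hm⟩ : ∃ m, m = ⌈τ⁻¹ * R * Real.log (N / ε)⌉₊ := ⟨_, rfl⟩
  rw [← hm] at hm1 hmθ
  rw [hR, hN] at hmθ
  obtain ⟨S, hS, hpr⟩ := exists_good_restriction hd hk2 hτ (by linarith) hτk hε (by linarith)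
    hmθ p hp
  refine ⟨S, (Nat.cast_le.2 hS).trans hm1, le_trans ?_ hpr⟩
  rw [← one_div]
  exact one_div_le_one_div_of_le (by positivity) (eight_mul_pow_le hd)

/-! ### Decision trees -/

/-- Averaging over the values of one coordinate. -/
theorem unifE_update (i : Fin n) (f : Cube n → ℝ) :
    (unifE (fun x => f (Function.update x i (-1))) +
      unifE (fun x => f (Function.update x i 1))) / 2 = unifE f := by
  have h := unifE_comp_equiv (flip i) f
  have e : ∀ x, f (Function.update x i (-1)) + f (Function.update x i 1) = f x + f (flip i x) := by
    intro x
    have hx : f x = f (Function.update x i (x i)) := by rw [Function.update_eq_self]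
    have hf : f (flip i x) = f (Function.update x i (-x i)) := rfl
    rw [hx, hf]
    rcases Int.units_eq_one_or (x i) with h1 | h1 <;> rw [h1]
    · ring
    · rw [neg_neg]
  rw [← unifE_add]
  simp only [e, unifE_add, h]
  ring

/-- The partial assignment `ρ`, changed on `S` to the values in `x`. -/
def override (ρ : PartialAssignment n) (S : Finset (Fin n)) (x : Cube n) : PartialAssignment n :=
  fun i => if i ∈ S then some (x i) else ρ i

theorem override_insert (ρ : PartialAssignment n) {S : Finset (Fin n)} {a : Fin n} (ha : a ∉ S)
    (x : Cube n) (s : ℤˣ) :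
    override (Function.update ρ a (some s)) S x =
      override ρ (insert a S) (Function.update x a s) := by
  ext1 i
  unfold override
  by_cases h : i = a
  · subst h
    simp [ha]
  · simp [h]

namespace DecisionTree

theorem leafPr_nonneg {α : Type} (P : α → Prop) (T : DecisionTree n α) : 0 ≤ T.leafPr P := by
  classical
  induction T with
  | leaf a =>
    unfold leafPr
    split_ifs <;> norm_num
  | node i neg pos ih1 ih2 =>
    unfold leafPr
    linarith

theorem allLeaves_of_isTreeOf {d : ℕ} {p : MvPolynomial (Fin n) ℝ} (hp : p.totalDegree ≤ d) :
    ∀ (T : DecisionTree n (MvPolynomial (Fin n) ℝ)) (ρ : PartialAssignment n), T.IsTreeOf p ρ →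
      T.AllLeaves (fun q => q.totalDegree ≤ d)
  | leaf q, ρ, h => by
    rw [IsTreeOf] at h
    rw [AllLeaves, h]
    exact (totalDegree_restrict_le p ρ).trans hp
  | node i neg pos, ρ, h => by
    rw [IsTreeOf] at h
    exact ⟨allLeaves_of_isTreeOf hp neg _ h.2.1, allLeaves_of_isTreeOf hp pos _ h.2.2⟩

theorem onCube_leafAt {p : MvPolynomial (Fin n) ℝ} {x : Cube n} :
    ∀ (T : DecisionTree n (MvPolynomial (Fin n) ℝ)) (ρ : PartialAssignment n), T.IsTreeOf p ρ →
      (∀ i, (ρ i).getD (x i) = x i) → onCube (T.leafAt x) x = onCube p x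
  | leaf q, ρ, h, hx => by
    rw [IsTreeOf] at h
    rw [leafAt, h, onCube_restrict]
    simp only [hx]
  | node i neg pos, ρ, h, hx => by
    rw [IsTreeOf] at h
    rw [leafAt]
    have hupd : ∀ s, x i = s → ∀ j, (Function.update ρ i (some s) j).getD (x j) = x j := by
      intro s hs j
      by_cases hj : j = i
      · subst hj
        simp [hs]
      · simp [hj, hx]
    split_ifs with h1
    · exact onCube_leafAt pos _ h.2.2 (hupd 1 h1)
    · exact onCube_leafAt neg _ h.2.1 (hupd (-1) ((Int.units_eq_one_or _).resolve_left h1))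

/-- The complete tree on the coordinates of `S`, continued by the trees `t`. -/
theorem exists_query_then (p : MvPolynomial (Fin n) ℝ)
    (t : PartialAssignment n → DecisionTree n (MvPolynomial (Fin n) ℝ))
    (ht : ∀ σ, (t σ).IsTreeOf p σ) {D : ℕ} (hD : ∀ σ, (t σ).depth ≤ D) (S : Finset (Fin n)) :
    ∀ ρ : PartialAssignment n, (∀ i ∈ S, ρ i = none) →
      ∃ T : DecisionTree n (MvPolynomial (Fin n) ℝ), T.IsTreeOf p ρ ∧ T.depth ≤ S.card + D ∧
        ∀ P, T.leafPr P = unifE (fun x => (t (override ρ S x)).leafPr P) := by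
  induction S using Finset.induction_on with
  | empty =>
    intro ρ _
    refine ⟨t ρ, ht ρ, by simpa using hD ρ, fun P => ?_⟩
    have h : ∀ x, override ρ ∅ x = ρ := fun x => funext fun i => if_neg (Finset.notMem_empty i)
    simp only [h]
    exact (unifE_const _).symm
  | insert a S ha ih =>
    intro ρ hρ
    have hfree : ∀ s : ℤˣ, ∀ i ∈ S, Function.update ρ a (some s) i = none := by
      intro s i hi
      rw [Function.update_of_ne (ne_of_mem_of_not_mem hi ha)]
      exact hρ i (Finset.mem_insert_of_mem hi)
    obtain ⟨T₁, h1, h1d, h1p⟩ := ih _ (hfree (-1))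
    obtain ⟨T₂, h2, h2d, h2p⟩ := ih _ (hfree 1)
    refine ⟨node a T₁ T₂, ⟨hρ a (Finset.mem_insert_self _ _), h1, h2⟩, ?_, fun P => ?_⟩
    · rw [depth, Finset.card_insert_of_notMem ha]
      omega
    · rw [leafPr, h1p, h2p]
      simp only [override_insert ρ ha]
      exact unifE_update a fun x => (t (override ρ (insert a S) x)).leafPr P

/-- If every polynomial of degree at most `d` becomes good with probability at least `s` under a
random restriction of at most `L` coordinates, then `r` rounds of such restrictions, stopped at the
leaves that are already good, leave a bad leaf with probability at most `(1 - s) ^ r`. -/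
theorem exists_tree_of_rounds {d L : ℕ} {good : MvPolynomial (Fin n) ℝ → Prop} {s : ℝ}
    (hs : s ≤ 1)
    (hstep : ∀ q : MvPolynomial (Fin n) ℝ, q.totalDegree ≤ d → ∃ S : Finset (Fin n),
      S.card ≤ L ∧ s ≤ unifPr (fun x : Cube n => good (restrict q (assignOn S x))))
    {p : MvPolynomial (Fin n) ℝ} (hp : p.totalDegree ≤ d) (r : ℕ) :
    ∀ ρ : PartialAssignment n, ∃ T : DecisionTree n (MvPolynomial (Fin n) ℝ),
      T.IsTreeOf p ρ ∧ T.depth ≤ r * L ∧ 1 - (1 - s) ^ r ≤ T.leafPr good := by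
  classical
  induction r with
  | zero =>
    intro ρ
    refine ⟨leaf (restrict p ρ), rfl, by simp [depth], ?_⟩
    simpa using leafPr_nonneg good _
  | succ r ih =>
    intro ρ
    choose T hT hTd hTp using ih
    obtain ⟨S, hS, hpr⟩ := hstep (restrict p ρ) ((totalDegree_restrict_le p ρ).trans hp)
    obtain ⟨t, ht⟩ : ∃ t : PartialAssignment n → DecisionTree n (MvPolynomial (Fin n) ℝ),
        t = fun σ => if good (restrict p σ) then leaf (restrict p σ) else T σ := ⟨_, rfl⟩
    have ht1 : ∀ σ, (t σ).IsTreeOf p σ := by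
      intro σ
      rw [ht]
      dsimp only
      split_ifs
      · rfl
      · exact hT σ
    have ht2 : ∀ σ, (t σ).depth ≤ r * L := by
      intro σ
      rw [ht]
      dsimp only
      split_ifs
      · exact Nat.zero_le _
      · exact hTd σ
    have ht3 : ∀ σ, 1 - (1 - s) ^ r + (1 - s) ^ r * (if good (restrict p σ) then 1 else 0) ≤
        (t σ).leafPr good := by
      intro σ
      rw [ht]
      dsimp only
      split_ifs with h
      · simp [leafPr, h]
      · simpa using hTp σ
    obtain ⟨T', h1, h2, h3⟩ := exists_query_then p t ht1 ht2 (S.filter fun i => ρ i = none) ρ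
      fun i hi => (Finset.mem_filter.1 hi).2
    refine ⟨T', h1, ?_, ?_⟩
    · have := (Finset.card_filter_le S fun i => ρ i = none).trans hS
      rw [Nat.succ_mul]
      omega
    · have hover : ∀ x, restrict p (override ρ (S.filter fun i => ρ i = none) x) =
          restrict (restrict p ρ) (assignOn S x) := by
        intro x
        rw [restrict_restrict]
        congr 1
        ext1 i
        cases h : ρ i <;> simp [override, assignOn, h]
      rw [h3]
      have hs0 : 0 ≤ (1 - s) ^ r := pow_nonneg (by linarith) r
      calc 1 - (1 - s) ^ (r + 1) = 1 - (1 - s) ^ r + (1 - s) ^ r * s := by ring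
        _ ≤ 1 - (1 - s) ^ r + (1 - s) ^ r *
            unifPr (fun x : Cube n => good (restrict (restrict p ρ) (assignOn S x))) := by
          gcongr
        _ = unifE (fun x : Cube n => (1 - (1 - s) ^ r) + (1 - s) ^ r *
            (if good (restrict (restrict p ρ) (assignOn S x)) then 1 else 0)) := by
          rw [unifE_add, unifE_const, unifE_const_mul, unifPr]
        _ ≤ _ := by
          refine unifE_mono fun x => ?_
          rw [← hover]
          exact ht3 _

end DecisionTree

end PTF

/-! ### The regularity lemma -/

theorem mainTheorem6 :
    -- the decision tree
    (∃ K : ℕ, ∀ (n d : ℕ) (p : MvPolynomial (Fin n) ℝ), p.totalDegree ≤ d →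
      ∀ τ ε δ : ℝ, 0 < τ → τ < 1 / 4 → 0 < ε → ε < 1 / 4 → 0 < δ → δ < 1 / 4 →
        ∃ T : PTF.DecisionTree n (MvPolynomial (Fin n) ℝ),
          (T.depth : ℝ) ≤
              τ⁻¹ * ((d : ℝ) * Real.log τ⁻¹ * Real.log ε⁻¹) ^ (K * d) * Real.log δ⁻¹ ∧
          T.IsTreeOf p (fun _ => none) ∧
          T.AllLeaves (fun q => q.totalDegree ≤ d) ∧
          (∀ x : PTF.Cube n, PTF.onCube (T.leafAt x) x = PTF.onCube p x ∧
            PTF.threshold (T.leafAt x) x = PTF.threshold p x) ∧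
          1 - δ ≤ T.leafPr (fun q => PTF.IsRegular τ q ∨ PTF.HasConstantSign ε q)) ∧
    -- the one-step restriction
    (∃ K : ℕ, ∀ (n d : ℕ) (p : MvPolynomial (Fin n) ℝ), p.totalDegree ≤ d →
      ∀ τ ε : ℝ, 0 < τ → τ < 1 / 4 → 0 < ε → ε < 1 / 4 →
        ∃ S : Finset (Fin n),
          (S.card : ℝ) ≤ τ⁻¹ * ((d : ℝ) * Real.log τ⁻¹ * Real.log ε⁻¹) ^ (K * d) ∧
          ((2 : ℝ) ^ (K * d))⁻¹ ≤ PTF.unifPr (fun x : PTF.Cube n =>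
            PTF.IsRegular τ (PTF.restrict p (PTF.assignOn S x)) ∨
              PTF.HasConstantSign ε (PTF.restrict p (PTF.assignOn S x)))) := by
  -- `233 = 77 + 156`: a restriction costs the exponent `77 d`, and the number of rounds, at most
  -- `2 · 2^{77 d} log δ⁻¹ ≤ 2^{78 d} log δ⁻¹`, costs `156 d`, as the base has square at least `2`.
  refine ⟨⟨233, ?_⟩, ⟨77, fun n d p hp τ ε hτ hτ1 hε hε1 =>
    PTF.exists_one_step_restriction p hp hτ hτ1 hε hε1⟩⟩
  intro n d p hp τ ε δ hτ hτ1 hε hε1 hδ hδ1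
  have hlδ := PTF.four_thirds_le_log_inv hδ hδ1
  suffices h : ∃ T : PTF.DecisionTree n (MvPolynomial (Fin n) ℝ),
      (T.depth : ℝ) ≤ τ⁻¹ * ((d : ℝ) * Real.log τ⁻¹ * Real.log ε⁻¹) ^ (233 * d) * Real.log δ⁻¹ ∧
      T.IsTreeOf p (fun _ => none) ∧
      1 - δ ≤ T.leafPr (fun q => PTF.IsRegular τ q ∨ PTF.HasConstantSign ε q) by
    obtain ⟨T, h1, h2, h3⟩ := h
    have hval : ∀ x, PTF.onCube (T.leafAt x) x = PTF.onCube p x := fun x =>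
      PTF.DecisionTree.onCube_leafAt T _ h2 fun _ => rfl
    refine ⟨T, h1, h2, PTF.DecisionTree.allLeaves_of_isTreeOf hp T _ h2, fun x => ⟨hval x, ?_⟩, h3⟩
    rw [PTF.threshold, hval, PTF.threshold]
  rcases eq_or_ne d 0 with rfl | hd
  · refine ⟨.leaf p, ?_, (PTF.restrict_none p).symm, ?_⟩
    · simp only [PTF.DecisionTree.depth, Nat.cast_zero, mul_zero, pow_zero, mul_one]
      exact mul_nonneg (inv_pos.2 hτ).le (by linarith)
    · have := PTF.isRegular_of_totalDegree_eq_zero hτ.le (Nat.le_zero.1 hp)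
      simp only [PTF.DecisionTree.leafPr, this, true_or, if_true]
      linarith
  have hM2 := PTF.two_le_mul_log_mul_log_sq hd (PTF.four_thirds_le_log_inv hτ hτ1)
    (PTF.four_thirds_le_log_inv hε hε1)
  obtain ⟨M, hM⟩ : ∃ M, M = (d : ℝ) * Real.log τ⁻¹ * Real.log ε⁻¹ := ⟨_, rfl⟩
  have hM0 : 0 ≤ M := by
    rw [hM]
    have h1 := PTF.four_thirds_le_log_inv hτ hτ1
    have h2 := PTF.four_thirds_le_log_inv hε hε1
    positivity
  rw [← hM] at hM2 ⊢
  have hτi : 0 < τ⁻¹ := inv_pos.2 hτ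
  obtain ⟨Q, hQ⟩ : ∃ Q : ℝ, Q = 2 ^ (77 * d) := ⟨_, rfl⟩
  have hQ1 : 1 ≤ Q := by
    rw [hQ]
    exact one_le_pow₀ (by norm_num)
  obtain ⟨r, hr⟩ : ∃ r, r = ⌈Q * Real.log δ⁻¹⌉₊ := ⟨_, rfl⟩
  have hr1 : Q * Real.log δ⁻¹ ≤ r := by
    rw [hr]
    exact Nat.le_ceil _
  have hr2 : (r : ℝ) ≤ M ^ (156 * d) * Real.log δ⁻¹ := by
    have h1 : (r : ℝ) ≤ Q * Real.log δ⁻¹ + 1 := by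
      rw [hr]
      exact (Nat.ceil_lt_add_one (by positivity)).le
    have h2 : 2 * Q ≤ M ^ (156 * d) := by
      calc 2 * Q = 2 ^ (1 + 77 * d) := by rw [hQ, pow_add, pow_one]
        _ ≤ 2 ^ (78 * d) := pow_le_pow_right₀ (by norm_num) (by omega)
        _ ≤ (M ^ 2) ^ (78 * d) := by gcongr
        _ = M ^ (156 * d) := by
          rw [← pow_mul]
          congr 1
          ring
    nlinarith
  obtain ⟨T, h1, h2, h3⟩ := PTF.DecisionTree.exists_tree_of_rounds (n := n) (d := d)
    (L := ⌊τ⁻¹ * M ^ (77 * d)⌋₊) (s := Q⁻¹)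
    (good := fun q => PTF.IsRegular τ q ∨ PTF.HasConstantSign ε q) (inv_le_one_of_one_le₀ hQ1)
    (fun q hq => by
      obtain ⟨S, hS1, hS2⟩ := PTF.exists_one_step_restriction q hq hτ hτ1 hε hε1
      rw [← hM] at hS1
      rw [← hQ] at hS2
      exact ⟨S, Nat.le_floor hS1, hS2⟩) hp r (fun _ => none)
  refine ⟨T, ?_, h1, le_trans ?_ h3⟩
  · calc (T.depth : ℝ) ≤ r * ⌊τ⁻¹ * M ^ (77 * d)⌋₊ := by exact_mod_cast h2
      _ ≤ (M ^ (156 * d) * Real.log δ⁻¹) * (τ⁻¹ * M ^ (77 * d)) := by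
        gcongr
        exact Nat.floor_le (by positivity)
      _ = τ⁻¹ * (M ^ (156 * d) * M ^ (77 * d)) * Real.log δ⁻¹ := by ring
      _ = _ := by
        rw [← pow_add]
        congr 3
        ring
  · have h4 : (1 - Q⁻¹) ^ r ≤ δ := by
      refine PTF.one_sub_pow_le (inv_le_one_of_one_le₀ hQ1) hδ ?_
      calc Real.log δ⁻¹ = Q * Real.log δ⁻¹ * Q⁻¹ := by field_simp
        _ ≤ r * Q⁻¹ := by gcongr
    linarith
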